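/- **Theorem 3.3.** Let $1<p<\infty$ and let $\varphi\in L^1_{\rm loc}(0,\infty)$ be a nonnegative function with $$\int_0^\infty t^{1/p-1}\varphi(t)\,dt<\infty .$$ Let $H^p_-(\mathbb R)$ be the subspace, with the $L^p$-norm, of those complex-valued functions in $L^p(\mathbb R)$ whose Poisson extension to the upper half-plane, $$u(x+iy)=\frac1\pi\int_{-\infty}^{\infty}\frac{y}{(x-s)^2+y^2}\,f(s)\,ds\qquad(y>0),$$ is anti-holomorphic (i.e. $\bar u$ is holomorphic). Let $$H_\varphi f(x)=\int_0^\infty f\Big(\frac xt\Big)\frac{\varphi(t)}{t}\,dt ,\qquad Hf(x)=\frac1\pi\,\mathrm{p.v.}\!\int_{-\infty}^{\infty}\frac{f(y)}{x-y}\,dy$$ be the Hausdorff operator and the Hilbert transform. Then, for every $f\in H^p_-(\mathbb R)$, the integral defining $H_\varphi f(x)$ converges absolutely for almost every $x$; $H_\varphi$ is a bounded linear operator from $H^p_-(\mathbb R)$ into itself, with $$\|H_\varphi\|_{H^p_-(\mathbb R)\to H^p_-(\mathbb R)}=\int_0^\infty t^{1/p-1}\varphi(t)\,dt .$$ Moreover,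 for every $f\in H^p_-(\mathbb R)$ the principal value $Hf(x)$ exists for almost every $x$, $H$ is a bounded linear operator from $H^p_-(\mathbb R)$ into itself, and $H_\varphi$ commutes with $H$ on $H^p_-(\mathbb R)$: $H_\varphi(Hf)=H(H_\varphi f)$ for all $f\in H^p_-(\mathbb R)$. -/

import Mathlib

open MeasureTheory Set Filter Topology
open scoped ENNReal

noncomputable section

/-- The Hausdorff operator `H_φ f (x) = ∫₀^∞ f (x / t) (φ t / t) dt`. -/
def hausdorffOp (φ : ℝ → ℝ) (f : ℝ → ℂ) (x : ℝ) : ℂ :=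
  ∫ t in Ioi (0 : ℝ), f (x / t) * ((φ t / t : ℝ) : ℂ)

/-- The truncated Hilbert transform `(1 / π) ∫_{|x - y| > ε} f y / (x - y) dy`. For `f ∈ L^p`,
`1 ≤ p < ∞`, and `ε > 0` this integral converges absolutely. -/
def truncatedHilbert (f : ℝ → ℂ) (ε x : ℝ) : ℂ :=
  (1 / Real.pi : ℂ) * ∫ y in {y : ℝ | ε < |x - y|}, f y / ((x - y : ℝ) : ℂ)

/-- `g` is the Hilbert transform `(1 / π) p.v. ∫ f y / (x - y) dy` of `f`: the principal value
exists and equals `g x` for almost every `x`. -/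
def IsHilbertTransform (f g : ℝ → ℂ) : Prop :=
  ∀ᵐ x : ℝ, Tendsto (fun ε : ℝ => truncatedHilbert f ε x) (𝓝[>] 0) (𝓝 (g x))

/-- The Poisson kernel of the upper half-plane, `P_y (x) = (1 / π) y / (x² + y²)`. -/
def poissonKernelHalf (y x : ℝ) : ℝ := 1 / Real.pi * (y / (x ^ 2 + y ^ 2))

/-- The Poisson extension `u (x + i y) = (P_y * f) (x)` of `f` to the upper half-plane. -/
def poissonExt (f : ℝ → ℂ) (z : ℂ) : ℂ :=
  ∫ s : ℝ, ((poissonKernelHalf z.im (z.re - s) : ℝ) : ℂ) * f s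

/-- A function is anti-holomorphic on the open upper half-plane if its complex conjugate is
holomorphic there. -/
def AntiholomorphicOnUpper (u : ℂ → ℂ) : Prop :=
  DifferentiableOn ℂ (fun z => (starRingEnd ℂ) (u z)) {z : ℂ | 0 < z.im}

theorem poissonKernelHalf_bound {y : ℝ} (hy : 0 < y) (x : ℝ) :
    ‖poissonKernelHalf y x‖ ≤ 1 / Real.pi * (1 / y) := by
  unfold poissonKernelHalf
  have hpi := Real.pi_pos
  rw [Real.norm_of_nonneg (by positivity)]
  refine mul_le_mul_of_nonneg_left ?_ (by positivity)
  rw [div_le_div_iff₀ (by positivity) hy]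
  nlinarith [sq_nonneg x]

theorem poissonKernelHalf_integrable {y : ℝ} (hy : 0 < y) :
    Integrable (poissonKernelHalf y) := by
  have h := (integrable_inv_one_add_sq.comp_div hy.ne').const_mul (1 / Real.pi * (1 / y))
  refine h.congr (Eventually.of_forall fun x => ?_)
  have : (0 : ℝ) < x ^ 2 + y ^ 2 := by positivity
  have h2 : (0 : ℝ) < 1 + (x / y) ^ 2 := by positivity
  simp only [poissonKernelHalf]
  field_simp
  ring

theorem poissonKernelHalf_memLp {y : ℝ} (hy : 0 < y) {q : ℝ≥0∞} (hq : 1 ≤ q) :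
    MemLp (poissonKernelHalf y) q := by
  have h1 : MemLp (poissonKernelHalf y) 1 := memLp_one_iff_integrable.2
    (poissonKernelHalf_integrable hy)
  rcases eq_or_ne q ⊤ with rfl | hq'
  · exact memLp_top_of_bound h1.1 _ (Eventually.of_forall (poissonKernelHalf_bound hy))
  have hqr : 1 ≤ q.toReal := by
    rw [← ENNReal.toReal_one]
    exact ENNReal.toReal_mono hq' hq
  refine (integrable_norm_rpow_iff h1.1 (by positivity) hq').1 ?_
  refine ((poissonKernelHalf_integrable hy).norm.const_mul
    ((1 / Real.pi * (1 / y)) ^ (q.toReal - 1))).mono'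
    (h1.1.norm.aemeasurable.pow_const _).aestronglyMeasurable (Eventually.of_forall fun x => ?_)
  rw [Real.norm_of_nonneg (by positivity)]
  calc ‖poissonKernelHalf y x‖ ^ q.toReal
      = ‖poissonKernelHalf y x‖ ^ (q.toReal - 1) * ‖poissonKernelHalf y x‖ := by
        rw [← Real.rpow_add_one' (norm_nonneg _) (by linarith), sub_add_cancel]
    _ ≤ _ := by
        gcongr
        exact poissonKernelHalf_bound hy x

theorem poissonExt_integrable {p : ℝ≥0∞} (hp : 1 ≤ p) {f : ℝ → ℂ} (hf : MemLp f p) {z : ℂ}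
    (hz : 0 < z.im) :
    Integrable fun s : ℝ => ((poissonKernelHalf z.im (z.re - s) : ℝ) : ℂ) * f s := by
  obtain ⟨q, hq⟩ : ∃ q : ℝ≥0∞, ENNReal.HolderConjugate p q :=
    ⟨_, ENNReal.HolderConjugate.inv_one_sub_inv' hp⟩
  have hq1 : 1 ≤ q := hq.symm.one_le
  have h := (poissonKernelHalf_memLp hz hq1).comp_measurePreserving
    (Measure.measurePreserving_sub_left volume z.re)
  exact memLp_one_iff_integrable.1 (hf.mul (h.ofReal (K := ℂ)))

/-- `H^p_-(ℝ)`: the subspace of those functions in `L^p(ℝ)` (complex-valued) whose Poisson extension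
to the upper half-plane is anti-holomorphic, with the norm of `L^p(ℝ)`. -/
def hardyMinus (p : ℝ≥0∞) [hp : Fact (1 ≤ p)] : Submodule ℂ (Lp ℂ p (volume : Measure ℝ)) where
  carrier := {f | AntiholomorphicOnUpper (poissonExt f)}
  zero_mem' := by
    have h : ∀ z, poissonExt (⇑(0 : Lp ℂ p (volume : Measure ℝ))) z = 0 := fun z => by
      refine integral_eq_zero_of_ae ?_
      exact Eventually.of_forall fun s => by simp
    simp only [mem_ofPred_eq, AntiholomorphicOnUpper, h, map_zero]
    exact differentiableOn_const _
  add_mem' := by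
    intro f g hf hg
    refine (DifferentiableOn.add hf hg).congr fun z hz => ?_
    simp only [Pi.add_apply]
    rw [← map_add]
    congr 1
    unfold poissonExt
    rw [← integral_add (poissonExt_integrable hp.out (Lp.memLp f) hz)
      (poissonExt_integrable hp.out (Lp.memLp g) hz)]
    refine integral_congr_ae ?_
    filter_upwards [Lp.coeFn_add f g] with s hs
    rw [hs, Pi.add_apply, mul_add]
  smul_mem' := by
    intro c f hf
    refine (DifferentiableOn.const_mul hf ((starRingEnd ℂ) c)).congr fun z _ => ?_
    rw [← map_mul]
    congr 1
    unfold poissonExt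
    rw [← integral_const_mul]
    refine integral_congr_ae ?_
    filter_upwards [Lp.coeFn_smul c f] with s hs
    rw [hs, Pi.smul_apply, smul_eq_mul]
    ring

end

/-! The upper bound holds on all of `L^p`: `H_φ` is a superposition of dilations `f (x / t)`, each
of norm `t ^ (1 / p)`, so Minkowski's inequality (`lintegral_rpow_lintegral_dilation_le`) gives the
constant `∫ t ^ (1 / p - 1) φ t dt`.

Everything specific to `H^p_-` rests on `antiholomorphicOnUpper_poissonExt_iff`: the Poisson
extension of `f` is anti-holomorphic exactly when the Cauchy integral of `f` vanishes on the upper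
half-plane. Fubini turns the Cauchy integral of `H_φ f` at `z` into an average of Cauchy integrals
of `f` at the points `z / t`, so `H_φ` preserves `H^p_-`. The truncated Hilbert transform at `x` is
the Cauchy integral at `x + iε`, up to a factor `1 / π`, plus convolution with a kernel of integral
`i` dominated by twice the Poisson kernel. On `H^p_-` the Cauchy term is zero, hence `Hf = i f`
almost everywhere, and commutation with `H_φ` is commutation with a scalar.

The lower bound on the norm comes from iteration. For `a > 1 / p`, `H_φ` formally multiplies `x ^
(-a)` by `∫ t ^ (a - 1) φ t dt`. Some `f` in `H^p_-` has nonnegative imaginary part, at least `c x ^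
(-a)` for `x ≥ 1`. Keeping only `t ≤ R`, the bound survives each application of `H_φ`: with `B =
∫_0^R t ^ (a - 1) φ t dt`, the `n`-th iterate has imaginary part at least `c B ^ n x ^ (-a)` for `x
≥ R ^ n`. Comparing `L^p` norms and taking `n`-th roots removes all dependence on `f` and leaves `B
R ^ (1 / p - a) ≤ ‖H_φ‖` (`setIntegral_Ioc_le_norm_hausdorffHardy`); then `a → 1 / p` and `R → ∞`
together. -/

/-! ### Dilations and Minkowski's inequality. -/

theorem lintegral_comp_div_pos (g : ℝ → ℝ≥0∞) {t : ℝ} (ht : 0 < t) :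
    ∫⁻ x, g (x / t) = ENNReal.ofReal t * ∫⁻ x, g x := by
  have he : MeasurableEmbedding (fun x : ℝ => x * t⁻¹) :=
    (MeasurableEquiv.mulRight₀ t⁻¹ (inv_ne_zero ht.ne')).measurableEmbedding
  have h := Real.map_volume_mul_right (inv_ne_zero ht.ne')
  have h2 := he.lintegral_map (μ := volume) g
  rw [h, lintegral_smul_measure, inv_inv, abs_of_pos ht] at h2
  simpa [div_eq_mul_inv] using h2.symm

/-- This transfers almost-everywhere statements about `f` to `f (x / t)` for almost every pair `(x,
t)`, so that `H_φ` is well defined on classes in `L^p`. -/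
theorem quasiMeasurePreserving_div_Ioi :
    Measure.QuasiMeasurePreserving (fun q : ℝ × ℝ => q.1 / q.2)
      (volume.prod (volume.restrict (Ioi (0 : ℝ)))) volume := by
  refine ⟨by fun_prop, ?_⟩
  refine Measure.AbsolutelyContinuous.mk fun s hs h0 => ?_
  have hm : Measurable (fun q : ℝ × ℝ => q.1 / q.2) := by fun_prop
  rw [Measure.map_apply hm hs, Measure.prod_apply_symm (hm hs), lintegral_eq_zero_iff
    (measurable_measure_prodMk_right (hm hs))]
  refine (ae_restrict_iff' measurableSet_Ioi).2 (Eventually.of_forall fun t ht => ?_)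
  have h := lintegral_comp_div_pos (s.indicator 1) (mem_Ioi.1 ht)
  rw [lintegral_indicator_one hs, h0, mul_zero] at h
  have hm' : MeasurableSet ((fun x : ℝ => x / t) ⁻¹' s) := (measurable_id.div_const t) hs
  change volume ((fun x : ℝ => x / t) ⁻¹' s) = 0
  rw [← lintegral_indicator_one hm']
  exact h

/-- **Minkowski's inequality** for averages of dilations. -/
theorem lintegral_rpow_lintegral_dilation_le {r : ℝ} (hr : 1 < r) {g : ℝ → ℝ≥0∞}
    (hg : Measurable g) {w : ℝ → ℝ≥0∞} (hw : AEMeasurable w (volume.restrict (Ioi (0 : ℝ)))) :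
    ∫⁻ x, (∫⁻ t in Ioi (0 : ℝ), g (x / t) * w t) ^ r ≤
      (∫⁻ t in Ioi (0 : ℝ), ENNReal.ofReal (t ^ (1 / r)) * w t) ^ r * ∫⁻ x, g x ^ r := by
  have hr0 : 0 < r := by linarith
  have hc := Real.HolderConjugate.conjExponent hr
  set q := r.conjExponent
  set W : ℝ → ℝ≥0∞ := fun t => ENNReal.ofReal (t ^ (1 / r)) * w t with hW
  have hWm : AEMeasurable W (volume.restrict (Ioi (0 : ℝ))) := by
    refine AEMeasurable.mul ?_ hw
    fun_prop
  set A := ∫⁻ t in Ioi (0 : ℝ), W t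
  have hexp : 1 / r + 1 / q = 1 := by simpa using hc.one_div_add_one_div
  -- Hölder with respect to the measure `W t dt`: the integrand is `g (x / t) t ^ (-1 / r)` times `W
  -- = W ^ (1 / r) W ^ (1 / q)`. The resulting factor `t⁻¹` later cancels the Jacobian of `x ↦ x /
  -- t`.
  have hpt : ∀ x, (∫⁻ t in Ioi (0 : ℝ), g (x / t) * w t) ^ r ≤
      (∫⁻ t in Ioi (0 : ℝ), g (x / t) ^ r * (ENNReal.ofReal t⁻¹ * W t)) * A ^ (r / q) := by
    intro x
    have hgx : Measurable fun t => g (x / t) := hg.comp (by fun_prop)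
    have h1 : ∫⁻ t in Ioi (0 : ℝ), g (x / t) * w t =
        ∫⁻ t in Ioi (0 : ℝ), ((fun t => g (x / t) * ENNReal.ofReal (t ^ (-(1 / r))) *
          W t ^ (1 / r)) * fun t => W t ^ (1 / q)) t := by
      refine setLIntegral_congr_fun measurableSet_Ioi fun t ht => ?_
      have ht : 0 < t := ht
      simp only [Pi.mul_apply]
      rw [mul_assoc, ← ENNReal.rpow_add_of_nonneg _ _ (by positivity)
        (one_div_nonneg.2 hc.symm.nonneg), hexp, ENNReal.rpow_one, hW]
      simp only
      rw [mul_assoc, ← mul_assoc (ENNReal.ofReal (t ^ (-(1 / r)))),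
        ← ENNReal.ofReal_mul (by positivity), ← Real.rpow_add ht]
      simp
    rw [h1]
    have h2 := ENNReal.lintegral_mul_le_Lp_mul_Lq (volume.restrict (Ioi (0 : ℝ))) hc
      (f := fun t => g (x / t) * ENNReal.ofReal (t ^ (-(1 / r))) * W t ^ (1 / r))
      (g := fun t => W t ^ (1 / q)) (by
        refine AEMeasurable.mul (AEMeasurable.mul hgx.aemeasurable ?_) (hWm.pow_const _)
        fun_prop) (hWm.pow_const _)
    refine (ENNReal.rpow_le_rpow h2 hr0.le).trans (le_of_eq ?_)
    rw [ENNReal.mul_rpow_of_nonneg _ _ hr0.le, ← ENNReal.rpow_mul, ← ENNReal.rpow_mul,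
      one_div_mul_cancel hr0.ne', ENNReal.rpow_one]
    congr 1
    · refine setLIntegral_congr_fun measurableSet_Ioi fun t ht => ?_
      have ht : 0 < t := ht
      rw [ENNReal.mul_rpow_of_nonneg _ _ hr0.le, ENNReal.mul_rpow_of_nonneg _ _ hr0.le,
        ← ENNReal.rpow_mul, one_div_mul_cancel hr0.ne', ENNReal.rpow_one, mul_assoc,
        ENNReal.ofReal_rpow_of_nonneg (by positivity) hr0.le, ← Real.rpow_mul ht.le]
      congr 3
      rw [neg_mul, one_div_mul_cancel hr0.ne', Real.rpow_neg_one]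
    · congr 1
      · refine lintegral_congr fun t => ?_
        rw [← ENNReal.rpow_mul, one_div_mul_cancel hc.symm.pos.ne', ENNReal.rpow_one]
      · ring
  have hjoint : AEMeasurable (Function.uncurry fun (x t : ℝ) =>
      g (x / t) ^ r * (ENNReal.ofReal t⁻¹ * W t))
      (volume.prod (volume.restrict (Ioi (0 : ℝ)))) := by
    refine AEMeasurable.mul (Measurable.aemeasurable ?_) (AEMeasurable.comp_snd (f := fun t =>
      ENNReal.ofReal t⁻¹ * W t) ?_)
    · exact (hg.comp (by fun_prop)).pow_const _
    · exact AEMeasurable.mul (by fun_prop) hWm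
  calc ∫⁻ x, (∫⁻ t in Ioi (0 : ℝ), g (x / t) * w t) ^ r
      ≤ ∫⁻ x, (∫⁻ t in Ioi (0 : ℝ), g (x / t) ^ r * (ENNReal.ofReal t⁻¹ * W t)) * A ^ (r / q) :=
        lintegral_mono hpt
    _ = (∫⁻ x, ∫⁻ t in Ioi (0 : ℝ), g (x / t) ^ r * (ENNReal.ofReal t⁻¹ * W t)) * A ^ (r / q) :=
        lintegral_mul_const'' _ hjoint.lintegral_prod_right'
    _ = (∫⁻ t in Ioi (0 : ℝ), ∫⁻ x, g (x / t) ^ r * (ENNReal.ofReal t⁻¹ * W t)) * A ^ (r / q) := by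
        rw [lintegral_lintegral_swap hjoint]
    _ = (∫⁻ t in Ioi (0 : ℝ), W t * ∫⁻ x, g x ^ r) * A ^ (r / q) := by
        congr 1
        refine setLIntegral_congr_fun measurableSet_Ioi fun t ht => ?_
        have ht : 0 < t := ht
        have hgt : Measurable fun x => g (x / t) ^ r := (hg.comp (by fun_prop)).pow_const _
        rw [lintegral_mul_const _ hgt,
          lintegral_comp_div_pos (fun x => g x ^ r) ht, mul_comm, mul_comm _ (W t), mul_assoc,
          ← mul_assoc (ENNReal.ofReal t⁻¹), ← ENNReal.ofReal_mul (by positivity),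
          inv_mul_cancel₀ ht.ne', ENNReal.ofReal_one, one_mul]
    _ = A ^ r * ∫⁻ x, g x ^ r := by
        rw [lintegral_mul_const'' _ hWm, mul_right_comm]
        congr 1
        change A * A ^ (r / q) = A ^ r
        nth_rw 1 [← ENNReal.rpow_one A]
        rw [← ENNReal.rpow_add_of_nonneg _ _ zero_le_one (div_nonneg hr0.le hc.symm.nonneg)]
        congr 1
        have := hc.symm.pos.ne'
        field_simp at hexp ⊢
        linarith

/-! ### The Hausdorff operator on `L^p`. -/

section

/-- Nonnegative weights on `(0, ∞)` with `∫ t ^ (1 / r - 1) φ t dt < ∞`. -/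
structure IsHausdorffWeight (r : ℝ) (φ : ℝ → ℝ) : Prop where
  nonneg : ∀ t : ℝ, 0 < t → 0 ≤ φ t
  integrableOn : IntegrableOn (fun t : ℝ => t ^ (1 / r - 1) * φ t) (Ioi (0 : ℝ))

namespace IsHausdorffWeight

variable {r : ℝ} {φ : ℝ → ℝ}

theorem aestronglyMeasurable_div (h : IsHausdorffWeight r φ) :
    AEStronglyMeasurable (fun t => φ t / t) (volume.restrict (Ioi (0 : ℝ))) := by
  have h1 : AEStronglyMeasurable (fun t : ℝ => t ^ (-(1 / r)) * (t ^ (1 / r - 1) * φ t))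
      (volume.restrict (Ioi (0 : ℝ))) :=
    (Measurable.aestronglyMeasurable (by fun_prop)).mul h.integrableOn.1
  refine h1.congr ((ae_restrict_iff' measurableSet_Ioi).2 (Eventually.of_forall fun t ht => ?_))
  have ht : 0 < t := ht
  simp only
  rw [← mul_assoc, ← Real.rpow_add ht, show -(1 / r) + (1 / r - 1) = -1 by ring,
    Real.rpow_neg_one, div_eq_inv_mul]

theorem lintegral_eq (h : IsHausdorffWeight r φ) :
    ∫⁻ t in Ioi (0 : ℝ), ENNReal.ofReal (t ^ (1 / r)) * ENNReal.ofReal (φ t / t) =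
      ENNReal.ofReal (∫ t in Ioi (0 : ℝ), t ^ (1 / r - 1) * φ t) := by
  rw [ofReal_integral_eq_lintegral_ofReal h.integrableOn
    ((ae_restrict_iff' measurableSet_Ioi).2 (Eventually.of_forall fun t (ht : 0 < t) =>
      mul_nonneg (by positivity) (h.nonneg t ht)))]
  refine setLIntegral_congr_fun measurableSet_Ioi fun t ht => ?_
  have ht : 0 < t := ht
  rw [← ENNReal.ofReal_mul (by positivity), Real.rpow_sub_one ht.ne']
  congr 1
  ring

theorem integral_nonneg (h : IsHausdorffWeight r φ) :
    0 ≤ ∫ t in Ioi (0 : ℝ), t ^ (1 / r - 1) * φ t :=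
  setIntegral_nonneg measurableSet_Ioi fun t (ht : 0 < t) =>
    mul_nonneg (by positivity) (h.nonneg t ht)

theorem enorm_kernel (h : IsHausdorffWeight r φ) (c : ℂ) {t : ℝ} (ht : 0 < t) :
    ‖c * ((φ t / t : ℝ) : ℂ)‖ₑ = ‖c‖ₑ * ENNReal.ofReal (φ t / t) := by
  rw [enorm_mul]
  congr 1
  rw [← ofReal_norm, Complex.norm_real, Real.norm_of_nonneg (div_nonneg (h.nonneg t ht) ht.le)]

theorem aestronglyMeasurable_kernel (h : IsHausdorffWeight r φ) {f : ℝ → ℂ}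
    (hf : AEStronglyMeasurable f) :
    AEStronglyMeasurable (Function.uncurry fun x t : ℝ => f (x / t) * ((φ t / t : ℝ) : ℂ))
      (volume.prod (volume.restrict (Ioi (0 : ℝ)))) := by
  refine (hf.comp_quasiMeasurePreserving quasiMeasurePreserving_div_Ioi).mul ?_
  exact (Complex.continuous_ofReal.comp_aestronglyMeasurable h.aestronglyMeasurable_div).comp_snd

theorem lintegral_rpow_le (h : IsHausdorffWeight r φ) (hr : 1 < r) {f : ℝ → ℂ}
    (hf : StronglyMeasurable f) :
    ∫⁻ x, (∫⁻ t in Ioi (0 : ℝ), ‖f (x / t) * ((φ t / t : ℝ) : ℂ)‖ₑ) ^ r ≤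
      ENNReal.ofReal (∫ t in Ioi (0 : ℝ), t ^ (1 / r - 1) * φ t) ^ r * ∫⁻ x, ‖f x‖ₑ ^ r := by
  rw [← h.lintegral_eq]
  refine le_trans (le_of_eq ?_) (lintegral_rpow_lintegral_dilation_le hr hf.enorm
    (w := fun t => ENNReal.ofReal (φ t / t)) ?_)
  · refine lintegral_congr fun x => ?_
    congr 1
    exact setLIntegral_congr_fun measurableSet_Ioi fun t ht => h.enorm_kernel _ ht
  · exact h.aestronglyMeasurable_div.aemeasurable.ennreal_ofReal

end IsHausdorffWeight

section

variable {p : ℝ≥0∞} {φ : ℝ → ℝ}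

theorem one_lt_toReal {p : ℝ≥0∞} (hp1 : 1 < p) (hp : p ≠ ∞) : 1 < p.toReal := by
  rw [← ENNReal.toReal_one]
  exact (ENNReal.toReal_lt_toReal (by simp) hp).2 hp1

theorem hausdorffOp_congr_ae {f g : ℝ → ℂ} (φ : ℝ → ℝ) (hfg : f =ᵐ[volume] g) :
    ∀ᵐ x : ℝ, (fun t : ℝ => f (x / t) * ((φ t / t : ℝ) : ℂ)) =ᵐ[volume.restrict (Ioi 0)]
      fun t : ℝ => g (x / t) * ((φ t / t : ℝ) : ℂ) := by
  have h := quasiMeasurePreserving_div_Ioi.ae hfg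
  filter_upwards [Measure.ae_ae_of_ae_prod h] with x hx
  filter_upwards [hx] with t ht
  rw [ht]

theorem lintegral_dilation_memLp (hp1 : 1 < p) (hp : p ≠ ∞) (h : IsHausdorffWeight p.toReal φ)
    {f : ℝ → ℂ} (hf : StronglyMeasurable f) (hfp : MemLp f p) :
    ∫⁻ x, (∫⁻ t in Ioi (0 : ℝ), ‖f (x / t) * ((φ t / t : ℝ) : ℂ)‖ₑ) ^ p.toReal < ∞ := by
  have hr := one_lt_toReal hp1 hp
  refine (h.lintegral_rpow_le hr hf).trans_lt (ENNReal.mul_lt_top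
    (ENNReal.rpow_lt_top_of_nonneg (by linarith) ENNReal.ofReal_ne_top) ?_)
  exact lintegral_rpow_enorm_lt_top_of_eLpNorm_lt_top (by positivity) hp hfp.2

theorem ae_integrableOn_hausdorff (hp1 : 1 < p) (hp : p ≠ ∞) (h : IsHausdorffWeight p.toReal φ)
    {f : ℝ → ℂ} (hfp : MemLp f p) :
    ∀ᵐ x : ℝ, IntegrableOn (fun t : ℝ => f (x / t) * ((φ t / t : ℝ) : ℂ)) (Ioi (0 : ℝ)) := by
  have hr := one_lt_toReal hp1 hp
  set g := hfp.1.mk f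
  have hfg : f =ᵐ[volume] g := hfp.1.ae_eq_mk
  have hg : StronglyMeasurable g := hfp.1.stronglyMeasurable_mk
  have hgp : MemLp g p := hfp.ae_eq hfg
  have hm := h.aestronglyMeasurable_kernel hg.aestronglyMeasurable
  have h1 := ae_lt_top' (hm.enorm.lintegral_prod_right'.pow_const _)
    (lintegral_dilation_memLp hp1 hp h hg hgp).ne
  filter_upwards [h1, hm.prodMk_left, hausdorffOp_congr_ae φ hfg] with x hx hmx hc
  refine Integrable.congr ⟨hmx, ?_⟩ hc.symm
  exact (ENNReal.rpow_lt_top_iff_of_pos (by linarith)).1 hx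

theorem aestronglyMeasurable_hausdorffOp {r : ℝ} (h : IsHausdorffWeight r φ) {f : ℝ → ℂ}
    (hf : AEStronglyMeasurable f) : AEStronglyMeasurable (hausdorffOp φ f) :=
  (h.aestronglyMeasurable_kernel hf).integral_prod_right'

theorem hausdorffOp_ae_eq {f g : ℝ → ℂ} (φ : ℝ → ℝ) (hfg : f =ᵐ[volume] g) :
    hausdorffOp φ f =ᵐ[volume] hausdorffOp φ g := by
  filter_upwards [hausdorffOp_congr_ae φ hfg] with x hx
  exact integral_congr_ae hx

theorem eLpNorm_hausdorffOp_le (hp1 : 1 < p) (hp : p ≠ ∞) (h : IsHausdorffWeight p.toReal φ)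
    {f : ℝ → ℂ} (hf' : AEStronglyMeasurable f) :
    eLpNorm (hausdorffOp φ f) p ≤
      ENNReal.ofReal (∫ t in Ioi (0 : ℝ), t ^ (1 / p.toReal - 1) * φ t) * eLpNorm f p := by
  obtain ⟨g, hf, hfg⟩ := hf'
  rw [eLpNorm_congr_ae (hausdorffOp_ae_eq φ hfg), eLpNorm_congr_ae hfg]
  have hr := one_lt_toReal hp1 hp
  have hr0 : 0 < p.toReal := by linarith
  have hp0 : p ≠ 0 := by positivity
  rw [eLpNorm_eq_lintegral_rpow_enorm_toReal hp0 hp, eLpNorm_eq_lintegral_rpow_enorm_toReal hp0 hp]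
  calc _ ≤ (ENNReal.ofReal (∫ t in Ioi (0 : ℝ), t ^ (1 / p.toReal - 1) * φ t) ^ p.toReal *
        ∫⁻ x, ‖g x‖ₑ ^ p.toReal) ^ (1 / p.toReal) := by
        gcongr
        refine le_trans (lintegral_mono fun x => ?_) (h.lintegral_rpow_le hr hf)
        gcongr
        exact enorm_integral_le_lintegral_enorm _
    _ = _ := by
        rw [ENNReal.mul_rpow_of_nonneg _ _ (by positivity), ← ENNReal.rpow_mul,
          mul_one_div_cancel hr0.ne', ENNReal.rpow_one]

theorem memLp_hausdorffOp (hp1 : 1 < p) (hp : p ≠ ∞) (h : IsHausdorffWeight p.toReal φ)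
    {f : ℝ → ℂ} (hf : MemLp f p) : MemLp (hausdorffOp φ f) p :=
  ⟨aestronglyMeasurable_hausdorffOp h hf.1, (eLpNorm_hausdorffOp_le hp1 hp h hf.1).trans_lt
    (ENNReal.mul_lt_top ENNReal.ofReal_lt_top hf.2)⟩

variable [Fact (1 ≤ p)]

/-- The Hausdorff operator as a bounded operator on `L^p(ℝ)`. -/
noncomputable def hausdorffLp (hp1 : 1 < p) (hp : p ≠ ∞) (h : IsHausdorffWeight p.toReal φ) :
    Lp ℂ p (volume : Measure ℝ) →L[ℂ] Lp ℂ p (volume : Measure ℝ) :=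
  LinearMap.mkContinuous
    { toFun := fun f => (memLp_hausdorffOp hp1 hp h (Lp.memLp f)).toLp _
      map_add' := fun f g => by
        rw [← MemLp.toLp_add, MemLp.toLp_eq_toLp_iff]
        filter_upwards [hausdorffOp_ae_eq φ (Lp.coeFn_add f g),
          ae_integrableOn_hausdorff hp1 hp h (Lp.memLp f),
          ae_integrableOn_hausdorff hp1 hp h (Lp.memLp g)] with x hx hf hg
        rw [hx, Pi.add_apply, hausdorffOp, hausdorffOp, hausdorffOp, ← integral_add hf hg]
        simp only [Pi.add_apply, add_mul]
      map_smul' := fun c f => by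
        rw [RingHom.id_apply, ← MemLp.toLp_const_smul, MemLp.toLp_eq_toLp_iff]
        filter_upwards [hausdorffOp_ae_eq φ (Lp.coeFn_smul c f)] with x hx
        rw [hx, Pi.smul_apply, hausdorffOp, hausdorffOp, smul_eq_mul, ← integral_const_mul]
        simp only [Pi.smul_apply, smul_eq_mul, mul_assoc] }
    (∫ t in Ioi (0 : ℝ), t ^ (1 / p.toReal - 1) * φ t) fun f => by
      change ‖(memLp_hausdorffOp hp1 hp h (Lp.memLp f)).toLp _‖ ≤ _
      rw [Lp.norm_toLp, Lp.norm_def]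
      refine ENNReal.toReal_le_of_le_ofReal (mul_nonneg h.integral_nonneg ENNReal.toReal_nonneg) ?_
      rw [ENNReal.ofReal_mul h.integral_nonneg, ENNReal.ofReal_toReal (Lp.eLpNorm_ne_top f)]
      exact eLpNorm_hausdorffOp_le hp1 hp h (Lp.aestronglyMeasurable f)

theorem coeFn_hausdorffLp (hp1 : 1 < p) (hp : p ≠ ∞) (h : IsHausdorffWeight p.toReal φ)
    (f : Lp ℂ p (volume : Measure ℝ)) : hausdorffLp hp1 hp h f =ᵐ[volume] hausdorffOp φ f :=
  (memLp_hausdorffOp hp1 hp h (Lp.memLp f)).coeFn_toLp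

theorem norm_hausdorffLp_le (hp1 : 1 < p) (hp : p ≠ ∞) (h : IsHausdorffWeight p.toReal φ)
    (f : Lp ℂ p (volume : Measure ℝ)) : ‖hausdorffLp hp1 hp h f‖ ≤
      (∫ t in Ioi (0 : ℝ), t ^ (1 / p.toReal - 1) * φ t) * ‖f‖ :=
  (ContinuousLinearMap.le_opNorm _ _).trans (mul_le_mul_of_nonneg_right
    (LinearMap.mkContinuous_norm_le _ h.integral_nonneg _) (norm_nonneg _))

end

end

/-! ### Cauchy integrals and the characterization of `H^p_-`. -/

section

/-- The Cauchy integral `∫ f s / (z - s) ds` over the real line. -/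
noncomputable def cauchyIntegral (f : ℝ → ℂ) (z : ℂ) : ℂ := ∫ s : ℝ, f s * (z - s)⁻¹

theorem sub_ofReal_ne_zero {z : ℂ} (hz : 0 < z.im) (s : ℝ) : z - s ≠ 0 := by
  intro h
  have := congrArg Complex.im h
  simp at this
  linarith

theorem im_le_norm_sub_ofReal (z : ℂ) (s : ℝ) : z.im ≤ ‖z - s‖ := by
  have := Complex.abs_im_le_norm (z - s)
  simp only [Complex.sub_im, Complex.ofReal_im, sub_zero] at this
  exact (le_abs_self _).trans this

theorem measurable_inv_sub_ofReal (z : ℂ) : Measurable fun s : ℝ => (z - s)⁻¹ := by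
  fun_prop

/-- The kernel is bounded by `1 / z.im` and comparable to `1 / (1 + |s|)` at infinity, whose `q`-th
power is integrable for finite `q > 1`. -/
theorem memLp_inv_sub_ofReal {q : ℝ≥0∞} (hq : 1 < q) {z : ℂ} (hz : 0 < z.im) :
    MemLp (fun s : ℝ => (z - s)⁻¹) q := by
  have hbound : ∀ s : ℝ, ‖(z - s)⁻¹‖ ≤ ((1 + ‖z‖) / z.im + 1) * ‖(1 + ‖s‖)⁻¹‖ := by
    intro s
    have h1 := im_le_norm_sub_ofReal z s
    have h2 : ‖s‖ ≤ ‖z‖ + ‖z - s‖ := by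
      have := norm_sub_norm_le (s : ℂ) z
      rw [norm_sub_rev, Complex.norm_real] at this
      linarith
    have h0 : 0 < ‖z - s‖ := hz.trans_le h1
    have h3 : (0 : ℝ) < 1 + ‖s‖ := by positivity
    rw [norm_inv, norm_inv, Real.norm_of_nonneg h3.le, ← div_eq_mul_inv, inv_eq_one_div,
      div_le_div_iff₀ h0 h3, add_mul, div_mul_eq_mul_div, one_mul, one_mul]
    have h4 : 1 + ‖z‖ ≤ (1 + ‖z‖) * ‖z - s‖ / z.im := by
      rw [le_div_iff₀ hz]
      gcongr
    linarith
  rcases eq_or_ne q ⊤ with rfl | hq'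
  · refine memLp_top_of_bound (measurable_inv_sub_ofReal z).aestronglyMeasurable (z.im)⁻¹
      (Eventually.of_forall fun s => ?_)
    rw [norm_inv]
    exact inv_anti₀ hz (im_le_norm_sub_ofReal z s)
  · have hr := one_lt_toReal hq hq'
    have hm : AEStronglyMeasurable (fun s : ℝ => (1 + ‖s‖)⁻¹) volume :=
      Measurable.aestronglyMeasurable (by fun_prop)
    have hJ : MemLp (fun s : ℝ => (1 + ‖s‖)⁻¹) q := by
      refine (integrable_norm_rpow_iff hm (by positivity) hq').1 ?_
      refine (integrable_one_add_norm (E := ℝ) (μ := volume) (r := q.toReal) (by simpa)).congr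
        (Eventually.of_forall fun s => ?_)
      have h3 : (0 : ℝ) ≤ 1 + ‖s‖ := by positivity
      simp only
      rw [norm_inv, Real.norm_of_nonneg h3, Real.rpow_neg h3, Real.inv_rpow h3]
    exact hJ.of_le_mul (measurable_inv_sub_ofReal z).aestronglyMeasurable
      (Eventually.of_forall hbound)

variable {p : ℝ≥0∞}

theorem exists_holderConjugate (hp1 : 1 < p) (hp : p ≠ ∞) :
    ∃ q : ℝ≥0∞, 1 < q ∧ ENNReal.HolderConjugate p q := by
  have h : ENNReal.HolderConjugate p _ := ENNReal.HolderConjugate.inv_one_sub_inv' hp1.le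
  refine ⟨_, ?_, h⟩
  exact (ENNReal.HolderConjugate.lt_top_iff_one_lt p _).1 hp.lt_top

theorem integrable_mul_inv_sub (hp1 : 1 < p) (hp : p ≠ ∞) {f : ℝ → ℂ} (hf : MemLp f p) {z : ℂ}
    (hz : 0 < z.im) : Integrable fun s : ℝ => f s * (z - s)⁻¹ := by
  obtain ⟨q, hq, hpq⟩ := exists_holderConjugate hp1 hp
  exact hf.integrable_mul (memLp_inv_sub_ofReal hq hz)

theorem isOpen_upper : IsOpen {z : ℂ | 0 < z.im} := isOpen_lt continuous_const Complex.continuous_im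

theorem differentiableOn_cauchyIntegral (hp1 : 1 < p) (hp : p ≠ ∞) {f : ℝ → ℂ} (hf : MemLp f p) :
    DifferentiableOn ℂ (cauchyIntegral f) {z : ℂ | 0 < z.im} := by
  intro z hz
  have hz : 0 < z.im := hz
  refine DifferentiableAt.differentiableWithinAt ?_
  -- Moving `z` by less than half its height keeps its distance to each real point above half the
  -- original. This bounds the differentiated kernel `1 / |w - s| ^ 2` by `4 / z.im` times the
  -- kernel at `z`.
  have hlow : ∀ w ∈ Metric.ball z (z.im / 2), ∀ s : ℝ, ‖z - s‖ / 2 ≤ ‖w - s‖ := by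
    intro w hw s
    rw [Metric.mem_ball, dist_eq_norm, norm_sub_rev] at hw
    have h1 := im_le_norm_sub_ofReal z s
    have h2 := norm_add_le (z - w) (w - s)
    rw [sub_add_sub_cancel] at h2
    linarith
  have hd := hasDerivAt_integral_of_dominated_loc_of_deriv_le (μ := volume)
    (F := fun (w : ℂ) (s : ℝ) => f s * (w - s)⁻¹)
    (F' := fun (w : ℂ) (s : ℝ) => f s * (-1 / (w - s) ^ 2)) (x₀ := z)
    (bound := fun s : ℝ => 4 / z.im * ‖f s * (z - s)⁻¹‖)
    (Metric.ball_mem_nhds z (half_pos hz)) (Eventually.of_forall fun w =>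
      hf.1.mul (measurable_inv_sub_ofReal w).aestronglyMeasurable)
    (integrable_mul_inv_sub hp1 hp hf hz)
    (hf.1.mul (Measurable.aestronglyMeasurable (by fun_prop))) ?_
    ((integrable_mul_inv_sub hp1 hp hf hz).norm.const_mul _) ?_
  · exact hd.2.differentiableAt
  · refine Eventually.of_forall fun s w hw => ?_
    have h0 := hlow w hw s
    have h1 := im_le_norm_sub_ofReal z s
    have h2 : 0 < ‖z - s‖ := hz.trans_le h1
    rw [norm_mul, norm_mul, norm_div, norm_neg, norm_one, norm_pow, norm_inv, mul_left_comm]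
    refine mul_le_mul_of_nonneg_left ?_ (norm_nonneg _)
    calc 1 / ‖w - s‖ ^ 2 ≤ 1 / (‖z - s‖ / 2) ^ 2 := by gcongr
      _ = 4 / ‖z - s‖ * ‖z - s‖⁻¹ := by field_simp; norm_num
      _ ≤ 4 / z.im * ‖z - s‖⁻¹ := by gcongr
  · refine Eventually.of_forall fun s w hw => ?_
    have h0 : w - s ≠ 0 := by
      have h1 := hlow w hw s
      have h2 := im_le_norm_sub_ofReal z s
      rw [← norm_pos_iff]
      linarith
    exact (((hasDerivAt_id w).sub_const _).inv h0).const_mul _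

theorem tendsto_cauchyIntegral_mul_I (hp1 : 1 < p) (hp : p ≠ ∞) {f : ℝ → ℂ} (hf : MemLp f p) :
    Tendsto (fun y : ℝ => cauchyIntegral f (y * Complex.I)) atTop (𝓝 0) := by
  have hI : 0 < Complex.I.im := by simp
  have h := tendsto_integral_filter_of_dominated_convergence (μ := volume) (l := atTop)
    (F := fun (y : ℝ) (s : ℝ) => f s * (y * Complex.I - s)⁻¹) (f := fun _ => 0)
    -- The integrand at height `1` dominates those at heights `y ≥ 1`.
    (fun s : ℝ => ‖f s * (Complex.I - s)⁻¹‖) (Eventually.of_forall fun w =>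
      hf.1.mul (measurable_inv_sub_ofReal _).aestronglyMeasurable) ?_
    (integrable_mul_inv_sub hp1 hp hf hI).norm ?_
  · simpa [cauchyIntegral] using h
  · filter_upwards [eventually_ge_atTop 1] with y hy
    refine Eventually.of_forall fun s => ?_
    rw [norm_mul, norm_mul, norm_inv, norm_inv]
    refine mul_le_mul_of_nonneg_left (inv_anti₀ (norm_pos_iff.2 (sub_ofReal_ne_zero hI s)) ?_)
      (norm_nonneg _)
    rw [Complex.norm_def, Complex.norm_def]
    refine Real.sqrt_le_sqrt ?_
    simp only [Complex.normSq_apply, Complex.sub_re, Complex.sub_im, Complex.mul_re,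
      Complex.mul_im, Complex.I_re, Complex.I_im, Complex.ofReal_re, Complex.ofReal_im]
    nlinarith
  · refine Eventually.of_forall fun s => ?_
    rw [← mul_zero (f s)]
    refine Tendsto.const_mul _ (tendsto_inv₀_cobounded.comp ?_)
    rw [← tendsto_norm_atTop_iff_cobounded]
    refine tendsto_atTop_mono (fun y : ℝ => ?_) tendsto_id
    simpa using im_le_norm_sub_ofReal (y * Complex.I) s

/-- Differentiating along real lines with direction `v` shows that `v ↦ conj (w' z * v)` is complex
linear; comparing `v = 1` with `v = i` forces `w' z = 0`. -/
theorem deriv_eq_zero_of_differentiableAt_conj {w : ℂ → ℂ} {z : ℂ} (h1 : DifferentiableAt ℂ w z)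
    (h2 : DifferentiableAt ℂ (fun z => (starRingEnd ℂ) (w z)) z) : deriv w z = 0 := by
  have e1 : ∀ v : ℂ, HasDerivAt (fun t : ℝ => w (z + t * v)) (deriv w z * v) 0 := by
    intro v
    have hl : HasDerivAt (fun t : ℂ => z + t * v) v ((0 : ℝ) : ℂ) := by
      simpa using ((hasDerivAt_id _).mul_const v).const_add z
    have hw : HasDerivAt w (deriv w z) (z + ((0 : ℝ) : ℂ) * v) := by simpa using h1.hasDerivAt
    exact (HasDerivAt.comp (h₂ := w) ((0 : ℝ) : ℂ) hw hl).comp_ofReal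
  have e2 : ∀ v : ℂ, HasDerivAt (fun t : ℝ => (starRingEnd ℂ) (w (z + t * v)))
      (deriv (fun z => (starRingEnd ℂ) (w z)) z * v) 0 := by
    intro v
    have hl : HasDerivAt (fun t : ℂ => z + t * v) v ((0 : ℝ) : ℂ) := by
      simpa using ((hasDerivAt_id _).mul_const v).const_add z
    have hw : HasDerivAt (fun z => (starRingEnd ℂ) (w z))
      (deriv (fun z => (starRingEnd ℂ) (w z)) z) (z + ((0 : ℝ) : ℂ) * v) := by
        simpa using h2.hasDerivAt
    exact (HasDerivAt.comp (h₂ := fun z => (starRingEnd ℂ) (w z)) ((0 : ℝ) : ℂ) hw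
      hl).comp_ofReal
  have e3 : ∀ v : ℂ, (starRingEnd ℂ) (deriv w z * v) =
      deriv (fun z => (starRingEnd ℂ) (w z)) z * v := fun v =>
    HasDerivAt.unique (by simpa using (e1 v).star) (e2 v)
  have a1 := e3 1
  have a2 := e3 Complex.I
  rw [mul_one, mul_one] at a1
  rw [← a1, map_mul, Complex.conj_I, mul_neg, neg_eq_iff_add_eq_zero, ← two_mul] at a2
  simpa using a2

/-- The Poisson kernel is the real part of `(i / π) / (z - s)`. This splits the Poisson extension
into a holomorphic and an anti-holomorphic half. -/
theorem poissonKernelHalf_eq (z : ℂ) (s : ℝ) :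
    ((poissonKernelHalf z.im (z.re - s) : ℝ) : ℂ) =
      1 / 2 * (Complex.I / Real.pi * (z - s)⁻¹ +
        (starRingEnd ℂ) (Complex.I / Real.pi * (z - s)⁻¹)) := by
  have h := Complex.re_eq_add_conj (Complex.I / Real.pi * (z - s)⁻¹)
  rw [one_div_mul_eq_div, ← h, Complex.ofReal_inj, poissonKernelHalf]
  have h1 : Complex.normSq (z - s) = (z.re - s) ^ 2 + z.im ^ 2 := by
    simp [Complex.normSq_apply]; ring
  simp only [Complex.mul_re, Complex.div_ofReal_re, Complex.div_ofReal_im, Complex.I_re,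
    Complex.I_im, Complex.inv_im, h1, Complex.sub_im, Complex.ofReal_im]
  ring

theorem conj_poissonExt_eq (hp1 : 1 < p) (hp : p ≠ ∞) {f : ℝ → ℂ} (hf : MemLp f p) {z : ℂ}
    (hz : 0 < z.im) : (starRingEnd ℂ) (poissonExt f z) =
      1 / 2 * ((starRingEnd ℂ) (Complex.I / Real.pi * cauchyIntegral f z) +
        Complex.I / Real.pi * cauchyIntegral (fun s => (starRingEnd ℂ) (f s)) z) := by
  have hfc : MemLp (fun s => (starRingEnd ℂ) (f s)) p := hf.star
  have i1 := integrable_mul_inv_sub hp1 hp hf hz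
  have i2 := integrable_mul_inv_sub hp1 hp hfc hz
  have i3 : Integrable fun s : ℝ => (starRingEnd ℂ) (f s * (z - s)⁻¹) :=
    (LinearIsometryEquiv.integrable_comp_iff Complex.conjLIE).2 i1
  rw [poissonExt, cauchyIntegral, cauchyIntegral, map_mul, ← integral_conj, ← integral_conj,
    ← integral_const_mul, ← integral_const_mul, ← integral_add (i3.const_mul _) (i2.const_mul _),
    ← integral_const_mul]
  refine integral_congr_ae (Eventually.of_forall fun s => ?_)
  simp only
  rw [map_mul, Complex.conj_ofReal, poissonKernelHalf_eq]
  simp only [map_mul]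
  ring

/-- In `conj_poissonExt_eq` the term with the Cauchy integral of `conj f` is always holomorphic. So
anti-holomorphy makes both the Cauchy integral of `f` and its conjugate holomorphic; it is then
constant, and decay along the imaginary axis makes the constant zero. -/
theorem antiholomorphicOnUpper_poissonExt_iff (hp1 : 1 < p) (hp : p ≠ ∞) {f : ℝ → ℂ}
    (hf : MemLp f p) : AntiholomorphicOnUpper (poissonExt f) ↔
      ∀ z : ℂ, 0 < z.im → cauchyIntegral f z = 0 := by
  have hfc : MemLp (fun s => (starRingEnd ℂ) (f s)) p := hf.star
  have hd := differentiableOn_cauchyIntegral hp1 hp hf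
  have hdc := differentiableOn_cauchyIntegral hp1 hp hfc
  constructor
  · intro h
    have hc : DifferentiableOn ℂ (fun z => (starRingEnd ℂ) (Complex.I / Real.pi *
        cauchyIntegral f z)) {z : ℂ | 0 < z.im} := by
      refine ((DifferentiableOn.const_mul h 2).sub
        (hdc.const_mul (Complex.I / Real.pi))).congr fun z hz => ?_
      simp only [Pi.sub_apply]
      rw [conj_poissonExt_eq hp1 hp hf hz]
      ring
    have hw := hd.const_mul (Complex.I / Real.pi)
    have hconst : ∀ z : ℂ, 0 < z.im → ∀ w : ℂ, 0 < w.im → Complex.I / Real.pi *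
        cauchyIntegral f z = Complex.I / Real.pi * cauchyIntegral f w := by
      intro z hz w hw'
      refine IsOpen.is_const_of_deriv_eq_zero isOpen_upper
        (convex_halfSpace_im_gt 0).isPreconnected hw (fun x hx => ?_) hz hw'
      exact deriv_eq_zero_of_differentiableAt_conj
        ((hw x hx).differentiableAt (isOpen_upper.mem_nhds hx))
        ((hc x hx).differentiableAt (isOpen_upper.mem_nhds hx))
    intro z hz
    have hpi : Complex.I / (Real.pi : ℂ) ≠ 0 :=
      div_ne_zero Complex.I_ne_zero (Complex.ofReal_ne_zero.2 Real.pi_ne_zero)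
    refine tendsto_nhds_unique ?_ (tendsto_cauchyIntegral_mul_I hp1 hp hf)
    refine tendsto_const_nhds.congr' ?_
    filter_upwards [eventually_gt_atTop 0] with y hy
    exact mul_left_cancel₀ hpi (hconst z hz _ (by simpa using hy))
  · intro h
    refine (hdc.const_mul (1 / 2 * (Complex.I / Real.pi))).congr fun z hz => ?_
    rw [conj_poissonExt_eq hp1 hp hf hz, h z hz]
    simp only [mul_zero, map_zero]
    ring

theorem mem_hardyMinus_iff [Fact (1 ≤ p)] (hp1 : 1 < p) (hp : p ≠ ∞)
    (f : Lp ℂ p (volume : Measure ℝ)) :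
    f ∈ hardyMinus p ↔ ∀ z : ℂ, 0 < z.im → cauchyIntegral f z = 0 :=
  antiholomorphicOnUpper_poissonExt_iff hp1 hp (Lp.memLp f)

end

/-! ### Invariance of `H^p_-` under the Hausdorff operator, and an explicit Cauchy integral. -/

section

variable {p : ℝ≥0∞} {φ : ℝ → ℝ}

theorem integrable_kernel_mul_inv_sub (hp1 : 1 < p) (hp : p ≠ ∞)
    (h : IsHausdorffWeight p.toReal φ) {f : ℝ → ℂ} (hf : MemLp f p) {z : ℂ} (hz : 0 < z.im) :
    Integrable (Function.uncurry fun x t : ℝ => f (x / t) * ((φ t / t : ℝ) : ℂ) * (z - x)⁻¹)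
      (volume.prod (volume.restrict (Ioi (0 : ℝ)))) := by
  have hm : AEStronglyMeasurable (Function.uncurry fun x t : ℝ =>
      f (x / t) * ((φ t / t : ℝ) : ℂ) * (z - x)⁻¹)
      (volume.prod (volume.restrict (Ioi (0 : ℝ)))) :=
    (h.aestronglyMeasurable_kernel hf.1).mul
      (measurable_inv_sub_ofReal z).aestronglyMeasurable.comp_fst
  refine (integrable_prod_iff hm).2 ⟨?_, ?_⟩
  · filter_upwards [ae_integrableOn_hausdorff hp1 hp h hf] with x hx
    exact Integrable.mul_const (c := (z - x)⁻¹) hx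
  -- Since `φ ≥ 0`, integrating the absolute value in `t` produces `H_φ |f|`, again in `L^p`, hence
  -- integrable against the Cauchy kernel.
  · have hN : MemLp (hausdorffOp φ fun x => (‖f x‖ : ℂ)) p :=
      memLp_hausdorffOp hp1 hp h hf.norm.ofReal
    refine (integrable_mul_inv_sub hp1 hp hN hz).norm.congr (Eventually.of_forall fun x => ?_)
    simp only [Function.uncurry, norm_mul]
    rw [integral_mul_const]
    congr 1
    rw [hausdorffOp]
    have : ∀ t ∈ Ioi (0 : ℝ), ((‖f (x / t)‖ : ℝ) : ℂ) * ((φ t / t : ℝ) : ℂ) =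
        ((‖f (x / t)‖ * ‖((φ t / t : ℝ) : ℂ)‖ : ℝ) : ℂ) := fun t (ht : 0 < t) => by
      rw [Complex.norm_real, Real.norm_of_nonneg (div_nonneg (h.nonneg t ht) ht.le)]
      push_cast
      rfl
    rw [setIntegral_congr_fun measurableSet_Ioi this, integral_complex_ofReal, Complex.norm_real,
      Real.norm_of_nonneg (integral_nonneg fun t => by positivity)]

/-- Fubini, then `x = t s` and `z - t s = t (z / t - s)`. The points `z / t` stay in the upper
half-plane, which yields invariance of `H^p_-`. -/
theorem cauchyIntegral_hausdorffOp (hp1 : 1 < p) (hp : p ≠ ∞)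
    (h : IsHausdorffWeight p.toReal φ) {f : ℝ → ℂ} (hf : MemLp f p) {z : ℂ} (hz : 0 < z.im) :
    cauchyIntegral (hausdorffOp φ f) z =
      ∫ t in Ioi (0 : ℝ), ((φ t / t : ℝ) : ℂ) * cauchyIntegral f (z / t) := by
  rw [cauchyIntegral]
  simp only [hausdorffOp, ← integral_mul_const]
  rw [integral_integral_swap (integrable_kernel_mul_inv_sub hp1 hp h hf hz)]
  refine setIntegral_congr_fun measurableSet_Ioi fun t ht => ?_
  have ht : 0 < t := ht
  rw [cauchyIntegral, ← integral_const_mul]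
  have h1 := Measure.integral_comp_div (fun s : ℝ => f s * ((φ t / t : ℝ) : ℂ) * (z - t * s)⁻¹) t
  rw [abs_of_pos ht, ← integral_smul] at h1
  have htc : (t : ℂ) ≠ 0 := Complex.ofReal_ne_zero.2 ht.ne'
  convert h1 using 1
  · refine integral_congr_ae (Eventually.of_forall fun x => ?_)
    simp only
    push_cast
    rw [mul_div_cancel₀ _ htc]
  · refine integral_congr_ae (Eventually.of_forall fun x => ?_)
    simp only [Complex.real_smul]
    rw [show z - t * x = t * (z / t - x) by field_simp, mul_inv]
    field_simp

variable [Fact (1 ≤ p)]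

theorem hausdorffLp_mem_hardyMinus (hp1 : 1 < p) (hp : p ≠ ∞) (h : IsHausdorffWeight p.toReal φ)
    {f : Lp ℂ p (volume : Measure ℝ)} (hf : f ∈ hardyMinus p) :
    hausdorffLp hp1 hp h f ∈ hardyMinus p := by
  rw [mem_hardyMinus_iff hp1 hp] at hf ⊢
  intro z hz
  have h1 : cauchyIntegral (hausdorffLp hp1 hp h f) z = cauchyIntegral (hausdorffOp φ f) z := by
    refine integral_congr_ae ?_
    filter_upwards [coeFn_hausdorffLp hp1 hp h f] with x hx
    rw [hx]
  rw [h1, cauchyIntegral_hausdorffOp hp1 hp h (Lp.memLp f) hz]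
  refine setIntegral_eq_zero_of_forall_eq_zero fun t (ht : 0 < t) => ?_
  rw [hf _ (by rw [Complex.div_ofReal_im]; positivity), mul_zero]

/-- The Hausdorff operator as a bounded operator on `H^p_-(ℝ)`. -/
noncomputable def hausdorffHardy (hp1 : 1 < p) (hp : p ≠ ∞) (h : IsHausdorffWeight p.toReal φ) :
    hardyMinus p →L[ℂ] hardyMinus p :=
  ((hausdorffLp hp1 hp h).comp (hardyMinus p).subtypeL).codRestrict (hardyMinus p) fun f =>
    hausdorffLp_mem_hardyMinus hp1 hp h f.2

theorem coeFn_hausdorffHardy (hp1 : 1 < p) (hp : p ≠ ∞) (h : IsHausdorffWeight p.toReal φ)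
    (f : hardyMinus p) : (hausdorffHardy hp1 hp h f : ℝ → ℂ) =ᵐ[volume] hausdorffOp φ f :=
  coeFn_hausdorffLp hp1 hp h f

theorem norm_hausdorffHardy_le (hp1 : 1 < p) (hp : p ≠ ∞) (h : IsHausdorffWeight p.toReal φ) :
    ‖hausdorffHardy hp1 hp h‖ ≤ ∫ t in Ioi (0 : ℝ), t ^ (1 / p.toReal - 1) * φ t :=
  ContinuousLinearMap.opNorm_le_bound _ h.integral_nonneg fun f => norm_hausdorffLp_le hp1 hp h f

omit [Fact (1 ≤ p)] in
-- This puts `1 / (i - s)` in `H^p_-`. Both poles lie in the upper half-plane, so the integrand has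
-- a global primitive vanishing at `±∞`: `1 / (i - s)` if `z = i`, and otherwise a logarithm of `(z
-- - s) / (i - s)`, which tends to `1`.
theorem cauchyIntegral_inv_I_sub {z : ℂ} (hz : 0 < z.im) :
    cauchyIntegral (fun s : ℝ => (Complex.I - s)⁻¹) z = 0 := by
  have hI : 0 < Complex.I.im := by simp
  have hint : Integrable fun s : ℝ => (Complex.I - s)⁻¹ * (z - s)⁻¹ :=
    integrable_mul_inv_sub (p := 2) (by norm_num) (by norm_num)
      (memLp_inv_sub_ofReal (by norm_num) hI) hz
  have hder : ∀ (w : ℂ) (s : ℝ), HasDerivAt (fun s : ℝ => w - (s : ℂ)) (-1) s := fun w s => by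
    simpa using (HasDerivAt.ofReal_comp (hasDerivAt_id s)).const_sub w
  have hcob : Tendsto (fun s : ℝ => (Complex.I - s)⁻¹) (cocompact ℝ) (𝓝 0) := by
    refine tendsto_inv₀_cobounded.comp ?_
    rw [← tendsto_norm_atTop_iff_cobounded]
    refine tendsto_atTop_mono (fun s : ℝ => ?_) (tendsto_atTop_add_const_right _ (-1 : ℝ)
      (tendsto_norm_cocompact_atTop (E := ℝ)))
    have := norm_sub_norm_le (s : ℂ) Complex.I
    rw [norm_sub_rev, Complex.norm_real, Complex.norm_I] at this
    linarith
  have hbot := hcob.mono_left atBot_le_cocompact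
  have htop := hcob.mono_left atTop_le_cocompact
  rw [cauchyIntegral]
  rcases eq_or_ne z Complex.I with rfl | hzI
  · rw [integral_of_hasDerivAt_of_tendsto (fun s => ?_) hint hbot htop, sub_zero]
    refine ((hder Complex.I s).inv (sub_ofReal_ne_zero hI s)).congr_deriv ?_
    rw [neg_neg, one_div, sq, mul_inv]
  · have hlim : ∀ l : Filter ℝ, Tendsto (fun s : ℝ => (Complex.I - s)⁻¹) l (𝓝 0) →
        Tendsto (fun s : ℝ => (z - Complex.I)⁻¹ * Complex.log ((z - s) / (Complex.I - s))) l
          (𝓝 0) := by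
      intro l hl
      have h1 : Tendsto (fun s : ℝ => (z - s) / (Complex.I - s)) l (𝓝 1) := by
        have h2 := (hl.const_mul (z - Complex.I)).const_add 1
        rw [mul_zero, add_zero] at h2
        refine h2.congr fun s => ?_
        have := sub_ofReal_ne_zero hI s
        field_simp
        ring
      have h3 := (h1.clog (by simp)).const_mul (z - Complex.I)⁻¹
      simpa using h3
    rw [integral_of_hasDerivAt_of_tendsto (fun s => ?_) hint (hlim _ hbot) (hlim _ htop), sub_zero]
    have n1 := sub_ofReal_ne_zero hI s
    have n2 := sub_ofReal_ne_zero hz s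
    have n3 := sub_ne_zero.2 hzI
    -- A quotient in `(-∞, 0]` would give `z - s` and `i - s` imaginary parts of opposite sign, or
    -- make the former zero.
    have hslit : (z - s) / (Complex.I - s) ∈ Complex.slitPlane := by
      rw [Complex.mem_slitPlane_iff_not_le_zero, Complex.le_def]
      rintro ⟨hre, him⟩
      have e : z - s = ((z - s) / (Complex.I - s)) * (Complex.I - s) := by field_simp
      have e2 := congrArg Complex.im e
      rw [Complex.mul_im, him] at e2
      simp only [Complex.sub_im, Complex.ofReal_im, Complex.I_im, Complex.zero_re,
        Complex.zero_im] at e2 hre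
      linarith
    refine ((((hder z s).div (hder Complex.I s) n1).clog_real hslit).const_mul
      (z - Complex.I)⁻¹).congr_deriv ?_
    simp only [Pi.div_apply]
    field_simp
    ring

end

/-! ### Poisson averages at Lebesgue points and the Hilbert transform. -/

section

theorem poissonKernelHalf_nonneg {y : ℝ} (hy : 0 < y) (x : ℝ) : 0 ≤ poissonKernelHalf y x := by
  have := Real.pi_pos
  unfold poissonKernelHalf
  positivity

theorem measurable_poissonKernelHalf (y : ℝ) : Measurable (poissonKernelHalf y) := by
  unfold poissonKernelHalf
  fun_prop

theorem integral_poissonKernelHalf {y : ℝ} (hy : 0 < y) : ∫ x, poissonKernelHalf y x = 1 := by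
  have h := Measure.integral_comp_div (fun u : ℝ => (1 + u ^ 2)⁻¹) y
  rw [integral_univ_inv_one_add_sq, abs_of_pos hy, smul_eq_mul] at h
  have h2 : ∀ x, poissonKernelHalf y x = 1 / (Real.pi * y) * (1 + (x / y) ^ 2)⁻¹ := fun x => by
    have h1 : (0 : ℝ) < x ^ 2 + y ^ 2 := by positivity
    have h2 : (0 : ℝ) < 1 + (x / y) ^ 2 := by positivity
    have := Real.pi_pos
    unfold poissonKernelHalf
    field_simp
    ring
  simp only [h2]
  rw [integral_const_mul, h]
  have := Real.pi_pos
  field_simp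

theorem lintegral_poissonKernelHalf_sub {y : ℝ} (hy : 0 < y) (x : ℝ) :
    ∫⁻ s, ENNReal.ofReal (poissonKernelHalf y (x - s)) = 1 := by
  rw [← ofReal_integral_eq_lintegral_ofReal ((poissonKernelHalf_integrable hy).comp_sub_left x)
    (Eventually.of_forall fun s => poissonKernelHalf_nonneg hy _),
    integral_sub_left_eq_self (poissonKernelHalf y) volume x, integral_poissonKernelHalf hy,
    ENNReal.ofReal_one]

theorem setOf_lt_poissonKernelHalf {y t : ℝ} (hy : 0 < y) (ht : 0 < t) (x : ℝ) :
    {s : ℝ | t < poissonKernelHalf y (x - s)} =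
      Metric.ball x (Real.sqrt (y / (Real.pi * t) - y ^ 2)) := by
  ext s
  have hpi := Real.pi_pos
  have h1 : (0 : ℝ) < (x - s) ^ 2 + y ^ 2 := by positivity
  rw [mem_ofPred_eq, Metric.mem_ball, dist_comm, Real.dist_eq, Real.lt_sqrt (abs_nonneg _), sq_abs,
    lt_sub_iff_add_lt, lt_div_iff₀ (by positivity), poissonKernelHalf, div_mul_div_comm, one_mul,
    lt_div_iff₀ (by positivity)]
  constructor <;> intro h <;> linarith

/-- A local average bound for `g` at `x` bounds the Poisson average of `g` near `x`. -/
theorem setLIntegral_ball_poisson_le {y δ : ℝ} (hy : 0 < y) (x : ℝ) {η : ℝ≥0∞}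
    {g : ℝ → ℝ≥0∞} (hg : Measurable g) (h : ∀ r, 0 < r → r ≤ δ →
      ∫⁻ s in Metric.closedBall x r, g s ≤ η * volume (Metric.closedBall x r)) :
    ∫⁻ s in Metric.ball x δ, g s * ENNReal.ofReal (poissonKernelHalf y (x - s)) ≤ η := by
  have hP : Measurable fun s => poissonKernelHalf y (x - s) :=
    (measurable_poissonKernelHalf y).comp (by fun_prop)
  have hnn : ∀ s, 0 ≤ poissonKernelHalf y (x - s) := fun s => poissonKernelHalf_nonneg hy _
  -- Layer-cake formula for the measure with density `g`: superlevel sets of the Poisson kernel are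
  -- balls centred at `x`, where the hypothesis compares `g` with `η` times Lebesgue measure.
  have e1 := lintegral_withDensity_eq_lintegral_mul (volume.restrict (Metric.ball x δ)) hg
    hP.ennreal_ofReal
  simp only [Pi.mul_apply] at e1
  rw [← e1, lintegral_eq_lintegral_meas_lt _ (Eventually.of_forall hnn) hP.aemeasurable]
  calc _ ≤ ∫⁻ t in Ioi (0 : ℝ), η * volume {s : ℝ | t < poissonKernelHalf y (x - s)} := by
        refine setLIntegral_mono' measurableSet_Ioi fun t ht => ?_
        rw [setOf_lt_poissonKernelHalf hy ht]
        set ρ := Real.sqrt (y / (Real.pi * t) - y ^ 2)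
        rw [withDensity_apply _ measurableSet_ball, Measure.restrict_restrict measurableSet_ball]
        have hb : Metric.ball x ρ ∩ Metric.ball x δ = Metric.ball x (min ρ δ) := by
          ext s
          simp
        rw [hb]
        rcases le_or_gt (min ρ δ) 0 with h0 | h0
        · simp [Metric.ball_eq_empty.2 h0]
        · calc _ ≤ ∫⁻ s in Metric.closedBall x (min ρ δ), g s :=
                lintegral_mono_set Metric.ball_subset_closedBall
            _ ≤ η * volume (Metric.closedBall x (min ρ δ)) := h _ h0 (min_le_right _ _)
            _ ≤ η * volume (Metric.ball x ρ) := by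
              rw [Real.volume_closedBall, Real.volume_ball]
              gcongr
              exact min_le_left _ _
    _ = η * 1 := by
        rw [← lintegral_poissonKernelHalf_sub hy x, lintegral_eq_lintegral_meas_lt _
          (Eventually.of_forall hnn) hP.aemeasurable, lintegral_const_mul]
        exact Antitone.measurable fun a b hab => measure_mono fun s (hs : b < _) =>
          hab.trans_lt hs
    _ = η := mul_one η

theorem poissonKernelHalf_le_of_le_abs {y δ u : ℝ} (hy : 0 < y) (hδ : 0 < δ) (hu : δ ≤ |u|) :
    poissonKernelHalf y u ≤ y * ((1 + 1 / δ ^ 2) * poissonKernelHalf 1 u) := by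
  have hpi := Real.pi_pos
  have h2 : δ ^ 2 ≤ u ^ 2 := by
    rw [← sq_abs u]
    gcongr
  have hδ2 : 0 < δ ^ 2 := by positivity
  have hu2 : 0 < u ^ 2 := by linarith
  have h3 : 1 / (u ^ 2 + y ^ 2) ≤ (1 + 1 / δ ^ 2) * (1 / (u ^ 2 + 1)) := by
    rw [← mul_div_assoc, mul_one, div_le_div_iff₀ (by positivity) (by positivity)]
    have h4 : 1 ≤ 1 / δ ^ 2 * u ^ 2 := by
      rw [one_div_mul_eq_div, le_div_iff₀ hδ2]
      linarith
    have h5 : 0 ≤ (1 + 1 / δ ^ 2) * y ^ 2 := by positivity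
    linarith
  unfold poissonKernelHalf
  calc 1 / Real.pi * (y / (u ^ 2 + y ^ 2)) = 1 / Real.pi * y * (1 / (u ^ 2 + y ^ 2)) := by ring
    _ ≤ 1 / Real.pi * y * ((1 + 1 / δ ^ 2) * (1 / (u ^ 2 + 1))) := by gcongr
    _ = _ := by ring

variable {p : ℝ≥0∞}

/-- At almost every point the Poisson averages of `|f - f x|` tend to zero. -/
theorem ae_tendsto_lintegral_poisson (hp1 : 1 ≤ p) {f : ℝ → ℂ}
    (hf : StronglyMeasurable f) (hfp : MemLp f p) :
    ∀ᵐ x : ℝ, Tendsto (fun y : ℝ => ∫⁻ s, ‖f s - f x‖ₑ *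
      ENNReal.ofReal (poissonKernelHalf y (x - s))) (𝓝[>] 0) (𝓝 0) := by
  filter_upwards [(Besicovitch.vitaliFamily (volume : Measure ℝ)).ae_tendsto_lintegral_enorm_sub_div
    (hfp.locallyIntegrable hp1)] with x hx
  have hg : Measurable fun s => ‖f s - f x‖ₑ := (hf.sub stronglyMeasurable_const).enorm
  have hfin : ∫⁻ s, ‖f s - f x‖ₑ * ENNReal.ofReal (poissonKernelHalf 1 (x - s)) < ∞ := by
    have i1 := poissonExt_integrable hp1 hfp (z := x + Complex.I) (by simp)
    have i2 := ((poissonKernelHalf_integrable one_pos).comp_sub_left x).ofReal (𝕜 := ℂ).mul_const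
      (f x)
    have i3 := (i1.sub i2).2
    refine lt_of_le_of_lt (lintegral_mono fun s => le_of_eq ?_) i3
    simp only [Complex.add_im, Complex.ofReal_im, Complex.I_im, zero_add, Complex.add_re,
      Complex.ofReal_re, Complex.I_re, add_zero, Pi.sub_apply]
    change _ = ‖((poissonKernelHalf 1 (x - s) : ℝ) : ℂ) * f s -
      ((poissonKernelHalf 1 (x - s) : ℝ) : ℂ) * f x‖ₑ
    rw [← mul_sub, enorm_mul, mul_comm]
    congr 1
    rw [← ofReal_norm, Complex.norm_real, Real.norm_of_nonneg (poissonKernelHalf_nonneg one_pos _)]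
  have hx2 := hx.comp (Besicovitch.tendsto_filterAt volume x)
  rw [ENNReal.tendsto_nhds_zero] at hx2 ⊢
  intro η hη
  have hη2 : 0 < η / 2 := ENNReal.half_pos hη.ne'
  obtain ⟨δ, hδ, hδb⟩ := mem_nhdsGT_iff_exists_Ioc_subset.1 (hx2 _ hη2)
  have hδ : 0 < δ := hδ
  set C := ENNReal.ofReal (1 + 1 / δ ^ 2) *
    ∫⁻ s, ‖f s - f x‖ₑ * ENNReal.ofReal (poissonKernelHalf 1 (x - s)) with hC
  have hCfin : C ≠ ∞ := (ENNReal.mul_lt_top ENNReal.ofReal_lt_top hfin).ne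
  have hfar : ∀ᶠ y : ℝ in 𝓝[>] 0, ENNReal.ofReal y * C ≤ η / 2 := by
    have : Tendsto (fun y : ℝ => ENNReal.ofReal y * C) (𝓝[>] 0) (𝓝 0) := by
      have h0 : Tendsto (fun y : ℝ => ENNReal.ofReal y) (𝓝[>] 0) (𝓝 0) := by
        simpa using (ENNReal.tendsto_ofReal (tendsto_id (α := ℝ) (x := 𝓝 0))).mono_left
          nhdsWithin_le_nhds
      simpa using ENNReal.Tendsto.mul_const h0 (Or.inr hCfin)
    exact ENNReal.tendsto_nhds_zero.1 this _ hη2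
  filter_upwards [hfar, self_mem_nhdsWithin] with y hy1 hy
  have hy : 0 < y := hy
  rw [← lintegral_add_compl _ (measurableSet_ball (x := x) (ε := δ)), ← ENNReal.add_halves η]
  -- Inside the ball of radius `δ`, the Lebesgue point property bounds the average by `η / 2`;
  -- outside, the kernel is at most `y (1 + 1 / δ ^ 2)` times the kernel at height `1`.
  refine add_le_add ?_ (le_trans ?_ hy1)
  · refine setLIntegral_ball_poisson_le hy x hg fun r hr hrδ => ?_
    have := hδb ⟨hr, hrδ⟩
    simp only [Function.comp_apply] at this
    refine (ENNReal.div_le_iff ?_ ?_).1 this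
    · rw [Real.volume_closedBall]
      simpa using hr
    · rw [Real.volume_closedBall]
      exact ENNReal.ofReal_ne_top
  · rw [hC, ← mul_assoc, ← ENNReal.ofReal_mul hy.le, ← lintegral_const_mul' _ _
      ENNReal.ofReal_ne_top]
    refine (setLIntegral_mono' measurableSet_ball.compl fun s hs => ?_).trans
      (setLIntegral_le_lintegral _ _)
    rw [mul_left_comm, ← ENNReal.ofReal_mul (by positivity), mul_assoc y]
    gcongr
    refine poissonKernelHalf_le_of_le_abs hy hδ ?_
    rwa [mem_compl_iff, Metric.mem_ball, not_lt, dist_comm, Real.dist_eq] at hs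

/-- The difference of the truncated Hilbert kernel and the conjugate Poisson kernel. -/
noncomputable def truncatedConjKernel (ε t : ℝ) : ℝ :=
  1 / Real.pi * ((if ε < |t| then t⁻¹ else 0) - t / (t ^ 2 + ε ^ 2))

theorem measurable_truncatedConjKernel (ε : ℝ) : Measurable (truncatedConjKernel ε) := by
  unfold truncatedConjKernel
  refine Measurable.const_mul (Measurable.sub (Measurable.ite ?_ (by fun_prop) (by fun_prop))
    (by fun_prop)) _
  exact measurableSet_lt (by fun_prop) (by fun_prop)

/-- For `|t| > ε` the bracket equals `(ε / t) * ε / (t ^ 2 + ε ^ 2)`; for `|t| ≤ ε` only the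
conjugate Poisson term remains, with numerator at most `ε`. -/
theorem abs_truncatedConjKernel_le {ε : ℝ} (hε : 0 < ε) (t : ℝ) :
    |truncatedConjKernel ε t| ≤ poissonKernelHalf ε t := by
  have hpi := Real.pi_pos
  have hq : 0 < t ^ 2 + ε ^ 2 := by positivity
  unfold truncatedConjKernel poissonKernelHalf
  rw [abs_mul, abs_of_pos (by positivity : 0 < 1 / Real.pi)]
  refine mul_le_mul_of_nonneg_left ?_ (by positivity)
  split_ifs with h
  · have ht : t ≠ 0 := abs_pos.1 (hε.trans h)
    have e : t⁻¹ - t / (t ^ 2 + ε ^ 2) = ε / t * (ε / (t ^ 2 + ε ^ 2)) := by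
      field_simp
      ring
    rw [e, abs_mul, abs_of_pos (by positivity : 0 < ε / (t ^ 2 + ε ^ 2)), abs_div, abs_of_pos hε]
    refine mul_le_of_le_one_left (by positivity) ?_
    rw [div_le_one (hε.trans h)]
    exact h.le
  · rw [zero_sub, abs_neg, abs_div, abs_of_pos hq]
    gcongr
    exact not_lt.1 h

theorem truncatedConjKernel_neg (ε t : ℝ) :
    truncatedConjKernel ε (-t) = -truncatedConjKernel ε t := by
  unfold truncatedConjKernel
  rw [abs_neg, neg_sq]
  split_ifs
  · rw [inv_neg]
    ring
  · ring

theorem integral_truncatedConjKernel (ε : ℝ) : ∫ t, truncatedConjKernel ε t = 0 := by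
  have h := integral_neg_eq_self (truncatedConjKernel ε) volume
  simp only [truncatedConjKernel_neg, integral_neg] at h
  linarith

/-- The truncated Hilbert kernel minus the Cauchy kernel `1 / (π (t + i ε))`. -/
noncomputable def truncatedCauchyKernel (ε t : ℝ) : ℂ :=
  truncatedConjKernel ε t + Complex.I * poissonKernelHalf ε t

theorem norm_truncatedCauchyKernel_le {ε : ℝ} (hε : 0 < ε) (t : ℝ) :
    ‖truncatedCauchyKernel ε t‖ ≤ 2 * poissonKernelHalf ε t := by
  unfold truncatedCauchyKernel
  refine (norm_add_le _ _).trans ?_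
  rw [norm_mul, Complex.norm_I, one_mul, Complex.norm_real, Complex.norm_real, two_mul,
    Real.norm_of_nonneg (poissonKernelHalf_nonneg hε t)]
  gcongr
  exact abs_truncatedConjKernel_le hε t

theorem measurable_truncatedCauchyKernel (ε : ℝ) : Measurable (truncatedCauchyKernel ε) := by
  have h1 := measurable_truncatedConjKernel ε
  have h2 := measurable_poissonKernelHalf ε
  unfold truncatedCauchyKernel
  fun_prop

theorem integrable_truncatedCauchyKernel {ε : ℝ} (hε : 0 < ε) :
    Integrable (truncatedCauchyKernel ε) :=
  ((poissonKernelHalf_integrable hε).const_mul 2).mono'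
    (measurable_truncatedCauchyKernel ε).aestronglyMeasurable
    (Eventually.of_forall (norm_truncatedCauchyKernel_le hε))

/-- The real part is odd and the Poisson kernel has mass one. This is the source of the factor `i`
in `Hf = i f`. -/
theorem integral_truncatedCauchyKernel {ε : ℝ} (hε : 0 < ε) :
    ∫ t, truncatedCauchyKernel ε t = Complex.I := by
  have h1 : Integrable (truncatedConjKernel ε) :=
    (poissonKernelHalf_integrable hε).mono' (measurable_truncatedConjKernel ε).aestronglyMeasurable
      (Eventually.of_forall (abs_truncatedConjKernel_le hε))
  unfold truncatedCauchyKernel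
  rw [integral_add h1.ofReal ((poissonKernelHalf_integrable hε).ofReal.const_mul _),
    integral_const_mul, integral_complex_ofReal, integral_complex_ofReal,
    integral_truncatedConjKernel, integral_poissonKernelHalf hε]
  simp

theorem integrable_truncatedCauchyKernel_mul (hp1 : 1 ≤ p) {f : ℝ → ℂ} (hf : MemLp f p) {ε : ℝ}
    (hε : 0 < ε) (x : ℝ) : Integrable fun s => truncatedCauchyKernel ε (x - s) * f s := by
  have i1 := poissonExt_integrable hp1 hf (z := x + ε * Complex.I) (by simpa using hε)
  refine (i1.norm.const_mul 2).mono' (AEStronglyMeasurable.mul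
    ((measurable_truncatedCauchyKernel ε).comp (by fun_prop)).aestronglyMeasurable hf.1)
    (Eventually.of_forall fun s => ?_)
  simp only [Complex.add_im, Complex.ofReal_im, Complex.mul_im, Complex.I_im, zero_add,
    Complex.add_re, Complex.ofReal_re, Complex.I_re, Complex.mul_re, mul_zero, mul_one, sub_zero,
    add_zero]
  rw [norm_mul, norm_mul, ← mul_assoc, Complex.norm_real,
    Real.norm_of_nonneg (poissonKernelHalf_nonneg hε _)]
  gcongr
  exact norm_truncatedCauchyKernel_le hε _

theorem truncatedHilbert_eq (hp1 : 1 < p) (hp : p ≠ ∞) {f : ℝ → ℂ} (hf : MemLp f p) {ε : ℝ}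
    (hε : 0 < ε) (x : ℝ) : truncatedHilbert f ε x =
      1 / Real.pi * cauchyIntegral f (x + ε * Complex.I) +
        ∫ s, truncatedCauchyKernel ε (x - s) * f s := by
  have hz : 0 < ((x : ℂ) + ε * Complex.I).im := by simpa using hε
  have hS : MeasurableSet {y : ℝ | ε < |x - y|} := measurableSet_lt (by fun_prop) (by fun_prop)
  rw [truncatedHilbert, cauchyIntegral, ← integral_const_mul, ← integral_indicator hS,
    ← integral_const_mul, ← integral_add ((integrable_mul_inv_sub hp1 hp hf hz).const_mul _)
    (integrable_truncatedCauchyKernel_mul hp1.le hf hε x)]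
  refine integral_congr_ae (Eventually.of_forall fun s => ?_)
  simp only [indicator_apply, mem_ofPred_eq]
  have hinv : ((x : ℂ) + ε * Complex.I - s)⁻¹ =
      ((x - s : ℝ) - ε * Complex.I) / (((x - s) ^ 2 + ε ^ 2 : ℝ) : ℂ) := by
    have h1 : (x : ℂ) + ε * Complex.I - s ≠ 0 := sub_ofReal_ne_zero hz s
    have h2 : (((x - s) ^ 2 + ε ^ 2 : ℝ) : ℂ) ≠ 0 := by
      rw [Complex.ofReal_ne_zero]
      positivity
    rw [eq_div_iff h2, inv_mul_eq_iff_eq_mul₀ h1]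
    push_cast
    ring_nf
    rw [Complex.I_sq]
    ring
  rw [hinv, truncatedCauchyKernel, truncatedConjKernel, poissonKernelHalf]
  split_ifs
  · push_cast
    ring
  · push_cast
    ring

theorem isHilbertTransform_of_cauchyIntegral_eq_zero (hp1 : 1 < p) (hp : p ≠ ∞) {f : ℝ → ℂ}
    (hf : StronglyMeasurable f) (hfp : MemLp f p)
    (h : ∀ z : ℂ, 0 < z.im → cauchyIntegral f z = 0) :
    IsHilbertTransform f fun x => Complex.I * f x := by
  filter_upwards [ae_tendsto_lintegral_poisson hp1.le hf hfp] with x hx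
  rw [tendsto_iff_edist_tendsto_0]
  have hx2 := ENNReal.Tendsto.const_mul (a := 2) hx (Or.inr (by simp))
  rw [mul_zero] at hx2
  refine tendsto_of_tendsto_of_tendsto_of_le_of_le' tendsto_const_nhds hx2
    (Eventually.of_forall fun _ => bot_le) ?_
  filter_upwards [self_mem_nhdsWithin] with ε hε
  have hε : 0 < ε := hε
  have i1 := integrable_truncatedCauchyKernel_mul hp1.le hfp hε x
  have i2 := (integrable_truncatedCauchyKernel hε).comp_sub_left x
  -- The Cauchy term vanishes by hypothesis, and `i` is written as the integral of the kernel, so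
  -- the error is controlled by Poisson averages of `|f - f x|`.
  have e : truncatedHilbert f ε x - Complex.I * f x =
      ∫ s, truncatedCauchyKernel ε (x - s) * (f s - f x) := by
    rw [truncatedHilbert_eq hp1 hp hfp hε, h _ (by simpa using hε), mul_zero, zero_add,
      ← integral_truncatedCauchyKernel hε,
      ← integral_sub_left_eq_self (truncatedCauchyKernel ε) volume x, ← integral_mul_const,
      ← integral_sub i1 (i2.mul_const _)]
    simp only [mul_sub]
  rw [edist_eq_enorm_sub, e, ← lintegral_const_mul' _ _ (by simp)]
  refine (enorm_integral_le_lintegral_enorm _).trans (lintegral_mono fun s => ?_)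
  rw [enorm_mul, mul_comm, mul_left_comm]
  gcongr
  rw [← ofReal_norm, ← ENNReal.ofReal_ofNat, ← ENNReal.ofReal_mul (by norm_num)]
  exact ENNReal.ofReal_le_ofReal (norm_truncatedCauchyKernel_le hε _)

theorem isHilbertTransform_hardyMinus [Fact (1 ≤ p)] (hp1 : 1 < p) (hp : p ≠ ∞)
    (f : hardyMinus p) : IsHilbertTransform (f : ℝ → ℂ)
      (((Complex.I • ContinuousLinearMap.id ℂ (hardyMinus p)) f : hardyMinus p) : ℝ → ℂ) := by
  filter_upwards [isHilbertTransform_of_cauchyIntegral_eq_zero hp1 hp (Lp.stronglyMeasurable _)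
    (Lp.memLp _) ((mem_hardyMinus_iff hp1 hp _).1 f.2), Lp.coeFn_smul Complex.I
      (f : Lp ℂ p (volume : Measure ℝ))] with x h1 h2
  change Tendsto _ _ (𝓝 ((Complex.I • (f : Lp ℂ p (volume : Measure ℝ)) :
    Lp ℂ p (volume : Measure ℝ)) x))
  rw [h2]
  exact h1

end

/-! ### The lower bound for the norm, by iteration on power tails. -/

section

theorem le_of_forall_mul_pow_le {K M u q : ℝ} (hK : 0 < K) (hq : 0 ≤ q)
    (h : ∀ n : ℕ, K * u ^ n ≤ M * q ^ n) : u ≤ q := by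
  by_contra! hlt
  have hu0 : 0 < u := hq.trans_lt hlt
  have h1 : Tendsto (fun n : ℕ => M * (q / u) ^ n) atTop (𝓝 (M * 0)) :=
    (tendsto_pow_atTop_nhds_zero_of_lt_one (by positivity) ((div_lt_one hu0).2 hlt)).const_mul M
  rw [mul_zero] at h1
  refine hK.not_ge (ge_of_tendsto' h1 fun n => ?_)
  rw [div_pow, ← mul_div_assoc, le_div_iff₀ (by positivity)]
  exact h n

/-- The weight `t ^ (-a)` on `[1, ∞)`. -/
noncomputable def powerTail (a t : ℝ) : ℝ := if 1 ≤ t then t ^ (-a) else 0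

theorem isHausdorffWeight_powerTail {r a : ℝ} (ha : 1 / r < a) :
    IsHausdorffWeight r (powerTail a) := by
  constructor
  · intro t ht
    unfold powerTail
    split_ifs <;> positivity
  · have h1 : IntegrableOn (fun t : ℝ => t ^ (1 / r - 1 - a)) (Ici 1) := by
      rw [integrableOn_Ici_iff_integrableOn_Ioi]
      exact integrableOn_Ioi_rpow_of_lt (by linarith) one_pos
    have h2 := (h1.integrable_indicator measurableSet_Ici).integrableOn (s := Ioi (0 : ℝ))
    refine h2.congr_fun (fun t ht => ?_) measurableSet_Ioi
    have ht : 0 < t := ht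
    simp only [indicator_apply, mem_Ici, powerTail]
    split_ifs
    · rw [← Real.rpow_add ht, sub_eq_add_neg (1 / r - 1)]
    · rw [mul_zero]

variable {p : ℝ≥0∞} {φ : ℝ → ℝ}

/-- Positivity of `Im f` and `φ` allows part of the integral to be discarded. The set `s` and
minorant `u` are quantified after `x`, so they may depend on it. -/
theorem ae_setIntegral_le_im_hausdorffOp (hp1 : 1 < p) (hp : p ≠ ∞)
    (h : IsHausdorffWeight p.toReal φ) {f : ℝ → ℂ} (hf : MemLp f p)
    (hpos : ∀ᵐ x : ℝ, 0 ≤ (f x).im) :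
    ∀ᵐ x : ℝ, ∀ s ⊆ Ioi (0 : ℝ), MeasurableSet s → ∀ u : ℝ → ℝ,
      (∀ᵐ t ∂volume.restrict s, 0 ≤ u t ∧ u t ≤ (f (x / t)).im * (φ t / t)) →
      ∫ t in s, u t ≤ (hausdorffOp φ f x).im := by
  have hq := Measure.ae_ae_of_ae_prod (quasiMeasurePreserving_div_Ioi.ae hpos)
  filter_upwards [ae_integrableOn_hausdorff hp1 hp h hf, hq] with x hx hqx s hs hsm u hu
  have him : ∀ t, (f (x / t) * ((φ t / t : ℝ) : ℂ)).im = (f (x / t)).im * (φ t / t) := fun t => by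
    rw [Complex.im_mul_ofReal]
  have e : (hausdorffOp φ f x).im = ∫ t in Ioi (0 : ℝ), (f (x / t)).im * (φ t / t) := by
    have := Complex.imCLM.integral_comp_comm hx
    simp only [Complex.imCLM_apply, him] at this
    exact this.symm
  have hint : IntegrableOn (fun t => (f (x / t)).im * (φ t / t)) (Ioi 0) := by
    have := hx.im
    simp only [RCLike.im_to_complex, him] at this
    exact this
  rw [e]
  calc ∫ t in s, u t ≤ ∫ t in s, (f (x / t)).im * (φ t / t) :=
        integral_mono_of_nonneg (hu.mono fun t ht => ht.1) (hint.mono_set hs)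
          (hu.mono fun t ht => ht.2)
    _ ≤ _ := by
        refine setIntegral_mono_set hint ?_ (Eventually.of_forall hs)
        filter_upwards [hqx, ae_restrict_mem measurableSet_Ioi] with t ht ht0
        exact mul_nonneg ht (div_nonneg (h.nonneg t ht0) (mem_Ioi.1 ht0).le)

/-- The imaginary part of `f` is nonnegative, and at least `c x ^ (-a)` for `x ≥ X`. -/
def ImTailBound (a c X : ℝ) (f : ℝ → ℂ) : Prop :=
  ∀ᵐ x : ℝ, 0 ≤ (f x).im ∧ (X ≤ x → c * x ^ (-a) ≤ (f x).im)

theorem ImTailBound.congr {a c X : ℝ} {f g : ℝ → ℂ} (h : ImTailBound a c X f)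
    (hfg : f =ᵐ[volume] g) : ImTailBound a c X g := by
  filter_upwards [h, hfg] with x hx hfx
  rwa [← hfx]

/-- If `x ≥ X R` and `t ≤ R` then `x / t ≥ X`, and `(x / t) ^ (-a) = t ^ a * x ^ (-a)`: the tail
reproduces itself, multiplied by the truncated moment of `φ`. -/
theorem ImTailBound.hausdorffOp (hp1 : 1 < p) (hp : p ≠ ∞) (h : IsHausdorffWeight p.toReal φ)
    {f : ℝ → ℂ} (hf : MemLp f p) {a c X R : ℝ} (hc : 0 ≤ c) (hX : 0 < X) (hR : 0 < R)
    (hb : ImTailBound a c X f) :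
    ImTailBound a (c * ∫ t in Ioc 0 R, t ^ (a - 1) * φ t) (X * R) (hausdorffOp φ f) := by
  have hq := Measure.ae_ae_of_ae_prod (quasiMeasurePreserving_div_Ioi.ae hb)
  filter_upwards [ae_setIntegral_le_im_hausdorffOp hp1 hp h hf (hb.mono fun x hx => hx.1), hq]
    with x hx hqx
  refine ⟨?_, fun hxX => ?_⟩
  · simpa using hx ∅ (empty_subset _) MeasurableSet.empty (fun _ => 0) (by simp)
  · have hx0 : 0 < x := (mul_pos hX hR).trans_le hxX
    have e : c * (∫ t in Ioc 0 R, t ^ (a - 1) * φ t) * x ^ (-a) =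
        ∫ t in Ioc 0 R, c * x ^ (-a) * (t ^ (a - 1) * φ t) := by
      rw [integral_const_mul]
      ring
    rw [e]
    refine hx _ Ioc_subset_Ioi_self measurableSet_Ioc _ ?_
    filter_upwards [ae_restrict_of_ae_restrict_of_subset Ioc_subset_Ioi_self hqx,
      ae_restrict_mem measurableSet_Ioc] with t ht ht0
    have htp : 0 < t := ht0.1
    have hφ := h.nonneg t htp
    refine ⟨by positivity, ?_⟩
    have h1 : X ≤ x / t := by
      rw [le_div_iff₀ htp]
      exact (mul_le_mul_of_nonneg_left ht0.2 hX.le).trans hxX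
    have h2 : c * x ^ (-a) * (t ^ (a - 1) * φ t) = c * (x / t) ^ (-a) * (φ t / t) := by
      rw [Real.div_rpow hx0.le htp.le, Real.rpow_neg htp.le, Real.rpow_sub_one htp.ne']
      field_simp
    rw [h2]
    exact mul_le_mul_of_nonneg_right (ht.2 h1) (by positivity)

theorem inv_I_sub_ofReal_im (s : ℝ) : (-(Complex.I - s)⁻¹ : ℂ).im = 1 / (s ^ 2 + 1) := by
  rw [Complex.neg_im, Complex.inv_im]
  simp [Complex.normSq_apply, ← sq, neg_div]

theorem imTailBound_powerTail (hp1 : 1 < p) (hp : p ≠ ∞) {a : ℝ} (ha : 1 / p.toReal < a) :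
    ImTailBound a (2 ^ (-a - 1) / 2) 1
      (hausdorffOp (powerTail a) fun s : ℝ => -(Complex.I - s)⁻¹) := by
  have hr := one_lt_toReal hp1 hp
  have ha0 : 0 < a := lt_trans (by positivity) ha
  have hw := isHausdorffWeight_powerTail ha
  have hf : MemLp (fun s : ℝ => -(Complex.I - s)⁻¹) p :=
    (memLp_inv_sub_ofReal hp1 (by simp)).neg
  filter_upwards [ae_setIntegral_le_im_hausdorffOp hp1 hp hw hf (Eventually.of_forall fun s => by
    rw [inv_I_sub_ofReal_im]; positivity)] with x hx
  refine ⟨?_, fun hx1 => ?_⟩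
  · simpa using hx ∅ (empty_subset _) MeasurableSet.empty (fun _ => 0) (by simp)
  · have hx0 : 0 < x := one_pos.trans_le hx1
    have hsub : Ioc x (2 * x) ⊆ Ioi 0 := fun t ht => hx0.trans ht.1
    -- On `(x, 2x]`, `Im f (x / t) = 1 / ((x / t) ^ 2 + 1) ≥ 1 / 2` and `t ^ (-a - 1) ≥ (2 x) ^ (-a
    -- - 1)`; the length `x` of the interval gives the constant `2 ^ (-a - 1) / 2`.
    have h1 := hx (Ioc x (2 * x)) hsub measurableSet_Ioc (fun _ => 1 / 2 * (2 * x) ^ (-a - 1)) (by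
      filter_upwards [ae_restrict_mem measurableSet_Ioc] with t ht
      have ht0 : 0 < t := hsub ht
      refine ⟨by positivity, ?_⟩
      rw [inv_I_sub_ofReal_im, powerTail, if_pos (hx1.trans ht.1.le), ← Real.rpow_sub_one ht0.ne']
      refine mul_le_mul ?_ (Real.rpow_le_rpow_of_nonpos ht0 ht.2 (by linarith)) (by positivity)
        (by positivity)
      refine one_div_le_one_div_of_le (by positivity) ?_
      have : x / t ≤ 1 := (div_le_one ht0).2 ht.1.le
      have h3 : 0 ≤ x / t := by positivity
      nlinarith)
    refine le_trans (le_of_eq ?_) h1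
    rw [setIntegral_const, Measure.real, Real.volume_Ioc, ENNReal.toReal_ofReal (by linarith),
      Real.mul_rpow (by norm_num) hx0.le, Real.rpow_sub_one hx0.ne', smul_eq_mul]
    field_simp
    ring

variable [Fact (1 ≤ p)]

theorem ImTailBound.le_norm_rpow (hp1 : 1 < p) (hp : p ≠ ∞) {a c X : ℝ} (ha : 1 / p.toReal < a)
    (hc : 0 ≤ c) (hX : 0 < X) (f : Lp ℂ p (volume : Measure ℝ)) (h : ImTailBound a c X f) :
    c ^ p.toReal * (X ^ (1 - a * p.toReal) / (a * p.toReal - 1)) ≤ ‖f‖ ^ p.toReal := by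
  have hr := one_lt_toReal hp1 hp
  set r := p.toReal
  have hr0 : 0 < r := by linarith
  have har : 1 < a * r := (div_lt_iff₀ hr0).1 ha
  have e1 : ∫⁻ x, ‖f x‖ₑ ^ r = ENNReal.ofReal (‖f‖ ^ r) := by
    rw [Lp.norm_def, eLpNorm_eq_lintegral_rpow_enorm_toReal (by positivity) hp,
      ENNReal.toReal_rpow, ← ENNReal.rpow_mul, one_div_mul_cancel hr0.ne', ENNReal.rpow_one,
      ENNReal.ofReal_toReal]
    exact (lintegral_rpow_enorm_lt_top_of_eLpNorm_lt_top (by positivity) hp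
      (Lp.eLpNorm_lt_top f)).ne
  have e2 : ∫ x in Ioi X, c ^ r * x ^ (-(a * r)) = c ^ r * (X ^ (1 - a * r) / (a * r - 1)) := by
    rw [integral_const_mul, integral_Ioi_rpow_of_lt (by linarith) hX,
      show -(a * r) + 1 = 1 - a * r by ring, ← neg_sub (a * r) 1, neg_div_neg_eq]
  rw [← e2, ← ENNReal.ofReal_le_ofReal_iff (by positivity), ← e1,
    ofReal_integral_eq_lintegral_ofReal
      ((integrableOn_Ioi_rpow_of_lt (by linarith) hX).const_mul _)
      ((ae_restrict_iff' measurableSet_Ioi).2 (Eventually.of_forall fun t (ht : X < t) => by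
        have := hX.trans ht
        positivity))]
  refine (lintegral_mono_ae ?_).trans (setLIntegral_le_lintegral (Ioi X) _)
  filter_upwards [ae_restrict_of_ae h, ae_restrict_mem measurableSet_Ioi] with x hx hxX
  have hxX : X < x := hxX
  have hx0 : 0 < x := hX.trans hxX
  rw [← ofReal_norm, ENNReal.ofReal_rpow_of_nonneg (norm_nonneg _) hr0.le]
  refine ENNReal.ofReal_le_ofReal ?_
  rw [← neg_mul, Real.rpow_mul hx0.le, ← Real.mul_rpow hc (by positivity)]
  refine Real.rpow_le_rpow (by positivity) ?_ hr0.le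
  exact (hx.2 hxX.le).trans ((le_abs_self _).trans (Complex.abs_im_le_norm _))

/-- The function `-1 / (i - s)` lies in `H^p_-` with positive imaginary part. Applying the Hausdorff
operator with weight `powerTail a` stays in the space and supplies the tail `x ^ (-a)`. -/
theorem exists_hardyMinus_imTailBound (hp1 : 1 < p) (hp : p ≠ ∞) {a : ℝ} (ha : 1 / p.toReal < a) :
    ∃ f : hardyMinus p, ImTailBound a (2 ^ (-a - 1) / 2) 1 f := by
  have hf : MemLp (fun s : ℝ => -(Complex.I - s)⁻¹) p :=
    (memLp_inv_sub_ofReal hp1 (by simp)).neg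
  have hmem : hf.toLp _ ∈ hardyMinus p := by
    rw [mem_hardyMinus_iff hp1 hp]
    intro z hz
    rw [← neg_zero, ← cauchyIntegral_inv_I_sub hz, cauchyIntegral, cauchyIntegral, ← integral_neg]
    refine integral_congr_ae ?_
    filter_upwards [hf.coeFn_toLp] with s hs
    rw [hs, neg_mul]
  have hw := isHausdorffWeight_powerTail ha
  set g : hardyMinus p := ⟨hf.toLp _, hmem⟩
  have h1 : hausdorffOp (powerTail a) (fun s : ℝ => -(Complex.I - s)⁻¹) =ᵐ[volume]
      hausdorffOp (powerTail a) (g : ℝ → ℂ) := hausdorffOp_ae_eq _ hf.coeFn_toLp.symm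
  exact ⟨hausdorffHardy hp1 hp hw g, (imTailBound_powerTail hp1 hp ha).congr
    (h1.trans (coeFn_hausdorffHardy hp1 hp hw g).symm)⟩

theorem imTailBound_hausdorffHardy_pow (hp1 : 1 < p) (hp : p ≠ ∞)
    (h : IsHausdorffWeight p.toReal φ) {a c R : ℝ} (hc : 0 ≤ c) (hR : 0 < R) (f : hardyMinus p)
    (hf : ImTailBound a c 1 f) (n : ℕ) :
    ImTailBound a (c * (∫ t in Ioc 0 R, t ^ (a - 1) * φ t) ^ n) (R ^ n)
      ((hausdorffHardy hp1 hp h ^ n) f : hardyMinus p) := by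
  have hB : 0 ≤ ∫ t in Ioc 0 R, t ^ (a - 1) * φ t :=
    setIntegral_nonneg measurableSet_Ioc fun t ht =>
      mul_nonneg (Real.rpow_nonneg ht.1.le _) (h.nonneg t ht.1)
  induction n with
  | zero => simpa using hf
  | succ n ih =>
    have := ih.hausdorffOp hp1 hp h (Lp.memLp _) (by positivity) (by positivity) hR
    rw [mul_assoc, ← pow_succ, ← pow_succ] at this
    refine this.congr ?_
    rw [pow_succ' (hausdorffHardy hp1 hp h)]
    exact (coeFn_hausdorffHardy hp1 hp h _).symm

theorem setIntegral_Ioc_le_norm_hausdorffHardy (hp1 : 1 < p) (hp : p ≠ ∞)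
    (h : IsHausdorffWeight p.toReal φ) {a R : ℝ} (ha : 1 / p.toReal < a) (hR : 0 < R) :
    (∫ t in Ioc 0 R, t ^ (a - 1) * φ t) * R ^ (1 / p.toReal - a) ≤ ‖hausdorffHardy hp1 hp h‖ := by
  have hr0 : 0 < p.toReal := by linarith [one_lt_toReal hp1 hp]
  have har : 0 < a * p.toReal - 1 := sub_pos.2 ((div_lt_iff₀ hr0).1 ha)
  obtain ⟨f, hf⟩ := exists_hardyMinus_imTailBound hp1 hp ha
  set c : ℝ := 2 ^ (-a - 1) / 2
  have hc : 0 < c := by positivity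
  set T := hausdorffHardy hp1 hp h
  have hT : 0 ≤ ‖T‖ := ContinuousLinearMap.opNorm_nonneg T
  set B := ∫ t in Ioc 0 R, t ^ (a - 1) * φ t
  have hB : 0 ≤ B := setIntegral_nonneg measurableSet_Ioc fun t ht =>
    mul_nonneg (Real.rpow_nonneg ht.1.le _) (h.nonneg t ht.1)
  refine (Real.rpow_le_rpow_iff (mul_nonneg hB (Real.rpow_nonneg hR.le _))
    hT hr0).1 ?_
  -- The `p`-th powers of the norms are compared: `K` collects the tail constants of `f`, `M` its
  -- norm, and neither depends on `n`.
  refine le_of_forall_mul_pow_le (K := c ^ p.toReal / (a * p.toReal - 1))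
    (M := ‖f‖ ^ p.toReal) (div_pos (by positivity) har) (Real.rpow_nonneg hT _) fun n => ?_
  have h1 := (imTailBound_hausdorffHardy_pow hp1 hp h hc.le hR f hf n).le_norm_rpow hp1 hp ha
    (by positivity) (by positivity)
  have h2 : ‖(T ^ n) f‖ ≤ ‖T‖ ^ n * ‖f‖ := by
    clear h1
    induction n with
    | zero => simp
    | succ n ih =>
      rw [pow_succ' T, pow_succ', mul_assoc]
      exact (T.le_opNorm _).trans (mul_le_mul_of_nonneg_left ih hT)
  have h3 : ‖(T ^ n) f‖ ^ p.toReal ≤ (‖T‖ ^ n * ‖f‖) ^ p.toReal :=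
    Real.rpow_le_rpow (norm_nonneg _) h2 hr0.le
  refine (le_of_eq ?_).trans ((h1.trans h3).trans (le_of_eq ?_))
  · rw [Real.mul_rpow hc.le (by positivity), Real.mul_rpow hB (by positivity), mul_pow,
      ← Real.rpow_mul hR.le, sub_mul, one_div_mul_cancel hr0.ne', ← Real.rpow_natCast,
      ← Real.rpow_natCast, ← Real.rpow_natCast, ← Real.rpow_natCast, ← Real.rpow_mul hB,
      ← Real.rpow_mul hB, ← Real.rpow_mul hR.le, ← Real.rpow_mul hR.le, mul_comm (n : ℝ),
      mul_comm (n : ℝ)]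
    ring
  · rw [Real.mul_rpow (pow_nonneg hT n) (norm_nonneg _), ← Real.rpow_natCast, ← Real.rpow_natCast,
      ← Real.rpow_mul hT, ← Real.rpow_mul hT, mul_comm (n : ℝ), mul_comm]

/-- Take `a = 1 / p + 1 / (n + 1)` and `R = n + 1`. The previous bound then has the extra factor `(t
/ R) ^ (1 / R)` on `(0, R]`, which is at most `1` and tends to `1` because `R ^ (1 / R) → 1`;
dominated convergence concludes. -/
theorem le_norm_hausdorffHardy (hp1 : 1 < p) (hp : p ≠ ∞) (h : IsHausdorffWeight p.toReal φ) :
    ∫ t in Ioi (0 : ℝ), t ^ (1 / p.toReal - 1) * φ t ≤ ‖hausdorffHardy hp1 hp h‖ := by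
  set r := p.toReal
  have hlim : Tendsto (fun n : ℕ => ∫ t in Ioi (0 : ℝ), (Ioc 0 ((n : ℝ) + 1)).indicator
      (fun t => (t / (n + 1)) ^ (1 / ((n : ℝ) + 1)) * (t ^ (1 / r - 1) * φ t)) t) atTop
      (𝓝 (∫ t in Ioi (0 : ℝ), t ^ (1 / r - 1) * φ t)) := by
    refine tendsto_integral_of_dominated_convergence
      (fun t => ‖t ^ (1 / r - 1) * φ t‖) (fun n => ?_) h.integrableOn.norm (fun n => ?_) ?_
    · exact AEStronglyMeasurable.indicator ((Measurable.aestronglyMeasurable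
        (by fun_prop)).mul h.integrableOn.1) measurableSet_Ioc
    · refine Eventually.of_forall fun t => ?_
      rw [indicator_apply]
      split_ifs with ht
      · have hn : (0 : ℝ) < n + 1 := by positivity
        have ht0 : 0 ≤ t / (n + 1) := div_nonneg ht.1.le hn.le
        rw [norm_mul, Real.norm_of_nonneg (by positivity)]
        refine mul_le_of_le_one_left (norm_nonneg _) (Real.rpow_le_one ht0 ?_ (by positivity))
        exact (div_le_one hn).2 ht.2
      · rw [norm_zero]
        exact norm_nonneg _
    · refine (ae_restrict_iff' measurableSet_Ioi).2 (Eventually.of_forall fun t (ht : 0 < t) => ?_)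
      have hn : Tendsto (fun n : ℕ => (n : ℝ) + 1) atTop atTop :=
        tendsto_atTop_add_const_right _ _ tendsto_natCast_atTop_atTop
      have l1 : Tendsto (fun n : ℕ => ((n : ℝ) + 1) ^ (1 / ((n : ℝ) + 1))) atTop (𝓝 1) :=
        tendsto_rpow_div.comp hn
      have l2 : Tendsto (fun n : ℕ => t ^ (1 / ((n : ℝ) + 1))) atTop (𝓝 1) := by
        have := (tendsto_const_nhds (x := t)).rpow tendsto_one_div_add_atTop_nhds_zero_nat
          (Or.inl ht.ne')
        rwa [Real.rpow_zero] at this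
      have l3 := (l2.div l1 one_ne_zero).mul_const (t ^ (1 / r - 1) * φ t)
      rw [div_one, one_mul] at l3
      refine l3.congr' ?_
      filter_upwards [hn.eventually_ge_atTop t] with n hnt
      rw [indicator_of_mem (mem_Ioc.2 ⟨ht, hnt⟩), Real.div_rpow ht.le (by positivity)]
      rfl
  refine le_of_tendsto' hlim fun n => ?_
  have hn : (0 : ℝ) < (n : ℝ) + 1 := by positivity
  refine le_trans (le_of_eq ?_) (setIntegral_Ioc_le_norm_hausdorffHardy hp1 hp h
    (a := 1 / r + 1 / ((n : ℝ) + 1)) (lt_add_of_pos_right _ (by positivity)) hn)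
  rw [setIntegral_indicator measurableSet_Ioc, inter_eq_self_of_subset_right Ioc_subset_Ioi_self,
    ← integral_mul_const]
  refine setIntegral_congr_fun measurableSet_Ioc fun t ht => ?_
  rw [show 1 / r - (1 / r + 1 / ((n : ℝ) + 1)) = -(1 / ((n : ℝ) + 1)) by ring,
    show 1 / r + 1 / ((n : ℝ) + 1) - 1 = 1 / ((n : ℝ) + 1) + (1 / r - 1) by ring,
    Real.rpow_add ht.1, Real.div_rpow ht.1.le hn.le, Real.rpow_neg hn.le]
  ring

end

theorem theorem3p3 (p : ℝ≥0∞) [Fact (1 ≤ p)] (hp1 : 1 < p) (hp : p ≠ ∞)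
    (φ : ℝ → ℝ) (hφ_nonneg : ∀ t : ℝ, 0 < t → 0 ≤ φ t)
    (hφ_loc : LocallyIntegrableOn φ (Ioi (0 : ℝ)))
    (hφ : IntegrableOn (fun t : ℝ => t ^ (1 / p.toReal - 1) * φ t) (Ioi (0 : ℝ))) :
    -- for every f in H^p_-, the integral defining H_φ f converges absolutely at a.e. point
    (∀ f : hardyMinus p, ∀ᵐ x : ℝ,
      IntegrableOn (fun t : ℝ => (f : ℝ → ℂ) (x / t) * ((φ t / t : ℝ) : ℂ)) (Ioi (0 : ℝ))) ∧
    -- H_φ is a bounded operator T of H^p_- into itself, with the stated norm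
    ∃ T : hardyMinus p →L[ℂ] hardyMinus p,
      (∀ f : hardyMinus p, (T f : ℝ → ℂ) =ᵐ[volume] hausdorffOp φ (f : ℝ → ℂ)) ∧
      ‖T‖ = ∫ t in Ioi (0 : ℝ), t ^ (1 / p.toReal - 1) * φ t ∧
      -- the Hilbert transform is a bounded operator S on H^p_-, and it commutes with H_φ
      ∃ S : hardyMinus p →L[ℂ] hardyMinus p,
        (∀ f : hardyMinus p, IsHilbertTransform (f : ℝ → ℂ) (S f : ℝ → ℂ)) ∧
        T.comp S = S.comp T := by
  have h : IsHausdorffWeight p.toReal φ := ⟨hφ_nonneg, hφ⟩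
  refine ⟨fun f => ae_integrableOn_hausdorff hp1 hp h (Lp.memLp _), hausdorffHardy hp1 hp h,
    coeFn_hausdorffHardy hp1 hp h,
    (norm_hausdorffHardy_le hp1 hp h).antisymm (le_norm_hausdorffHardy hp1 hp h),
    Complex.I • ContinuousLinearMap.id ℂ (hardyMinus p), isHilbertTransform_hardyMinus hp1 hp, ?_⟩
  -- The Hilbert transform acts as the scalar `i`, so commutation is linearity of `T`.
  ext1 f
  simp
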